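/- For a set $K$ of positive integers let $\zeta_K(s)=\sum_{n\in K}n^{-s}$ for $\Re s>1$. For $I=(-T,T)$ with $0<T<\infty$, let $\mathcal Z_{K,I}$ be the operator on the complex Hilbert space $L^2(I)$ defined by $$\mathcal Z_{K,I}\,g(t)=\lim_{\delta\to0^+}\frac1\pi\int_I g(\tau)\,\Re\,\zeta_K\bigl(1+\delta+i(t-\tau)\bigr)\,d\tau ,\qquad t\in I,$$ the limit being taken in the norm of $L^2(I)$. Let $Q$ be a set of prime numbers, let $K$ be the set of positive integers all of whose prime divisors lie in $Q$, and let $J$ be the set of positive integers none of whose prime divisors lies in $Q$ (so $1\in K\cap J$). Then for every $0<T<\infty$, with $I=(-T,T)$, the limit defining $\mathcal Z_{K,I}\,g$ exists for every $g\in L^2(I)$, $\mathcal Z_{K,I}$ is a bounded linear operator on $L^2(I)$, and $$\mathcal Z_{K,I}=\zeta_J(1)^{-1}\,\mathrm{Id}+\Psi_{K,I}$$ for a compact operator $\Psi_{K,I}$ on $L^2(I)$, where $\zeta_J(1)=\sum_{n\in J}\frac1n\in[1,\infty]$ and $\infty^{-1}=0$. Moreover, $\mathcal Z_{K,I}$ is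 bounded below on $L^2(I)$, i.e. there is $c>0$ with $\|\mathcal Z_{K,I}\,g\|\ge c\|g\|$ for all $g\in L^2(I)$, if and only if $$\sum_{p\text{ prime},\ p\notin Q}\frac1p<\infty .$$ -/

import Mathlib

open MeasureTheory Filter Topology

open scoped ENNReal

noncomputable section

/-- The positive integers all of whose prime divisors lie in `Q`
(the multiplicative semigroup with unit generated by the primes in `Q`; it contains `1`). -/
def generatedIntegers (Q : Set ℕ) : Set ℕ :=
  {n | 0 < n ∧ ∀ p : ℕ, p.Prime → p ∣ n → p ∈ Q}

/-- The primes that do not belong to `Q`. -/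
def complementaryPrimes (Q : Set ℕ) : Set ℕ :=
  {p | p.Prime ∧ p ∉ Q}

/-- The `K`-zeta function `ζ_K(s) = ∑_{n ∈ K} n^{-s}`, absolutely convergent for `Re s > 1`. -/
def zetaK (K : Set ℕ) (s : ℂ) : ℂ :=
  ∑' n : K, 1 / ((n : ℕ) : ℂ) ^ s

/-- The value `ζ_K(1) = ∑_{n ∈ K} 1/n` as an extended nonnegative number;
it is `∞` when the series diverges. -/
def zetaKAtOne (K : Set ℕ) : ℝ≥0∞ :=
  ∑' n : K, (((n : ℕ) : ℝ≥0∞))⁻¹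

/-- The complex Hilbert space `L²(I)`, `I = (-T, T)`. -/
abbrev L2Interval (T : ℝ) : Type :=
  Lp ℂ 2 (volume.restrict (Set.Ioo (-T) T))

/-- The function `t ↦ (1/π) ∫_I g(τ) Re ζ_K(1 + δ + i(t - τ)) dτ`, where `I = (-T, T)`. -/
def zetaConvolution (K : Set ℕ) (T δ : ℝ) (g : L2Interval T) (t : ℝ) : ℂ :=
  (1 / (Real.pi : ℂ)) * ∫ τ in Set.Ioo (-T) T,
    g τ * (((zetaK K (1 + (δ : ℂ) + Complex.I * ((t : ℂ) - (τ : ℂ)))).re : ℝ) : ℂ)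

/-- `Z` is the operator `𝓩_{K,I}` on `L²(I)`, `I = (-T, T)`: for every `g ∈ L²(I)`, `Z g` is the
limit in `L²(I)`, as `δ → 0+`, of `(1/π) ∫_I g(τ) Re ζ_K(1 + δ + i(t - τ)) dτ`.
There is at most one such `Z`. -/
def IsZetaOperator (K : Set ℕ) (T : ℝ) (Z : L2Interval T →L[ℂ] L2Interval T) : Prop :=
  ∀ g : L2Interval T,
    Tendsto (fun δ : ℝ => eLpNorm (fun t => zetaConvolution K T δ g t - Z g t) 2
      (volume.restrict (Set.Ioo (-T) T))) (𝓝[>] 0) (𝓝 0)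

/-- The operator `Z` is bounded below in norm. -/
def IsBoundedBelow {T : ℝ} (Z : L2Interval T →L[ℂ] L2Interval T) : Prop :=
  ∃ c : ℝ, 0 < c ∧ ∀ g : L2Interval T, c * ‖g‖ ≤ ‖Z g‖

end

/-! Write `E_x` for the rank one operator `g ↦ ⟨e^{ixt}, g⟩ e^{ixt}` on `L²(I)`. Since `Re
n^{-1-δ-iu} = n^{-1-δ} cos(u log n)`, letting `δ → 0+` turns the zeta operator into `(2π)⁻¹ (A₊ +
A₋)`, where `A_± = ∑_{n ∈ K} n⁻¹ E_{± log n}`. These sums converge strongly because the vectors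
`n^{-1/2} e^{± i t log n}` form a Bessel sequence.

All integers: `n⁻¹ E_{log n}` differs from `∫ E_x dx` over `[log n, log (n + 1)]` by a compact
operator of norm `O(n⁻²)`. By Plancherel the two signs together give `∫_ℝ E_x dx = 2π Id`. Hence the
full sum is `2π Id` plus a compact operator (`logFrameOp_one_add_eq`), and the Bessel bound follows
from the same comparison (`isBessel_logVec`).

Integers free of a finite set `F` of primes: the indicator is periodic with mean `∏_{p ∈ F} (1 -
1/p)`. Abel summation shows that replacing it by its mean costs a compact operator
(`isCompactOperator_sieved_sub`).

General `K`: sieve by finite sets `F` of primes outside `Q`; the densities decrease to `1/ζ_J(1)` by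
the Euler product. If `∑ 1/p` converges over these primes, the sieved operators converge in norm,
because the multiples of `p` contribute a fraction `1/p` of the Bessel bound
(`norm_halfZetaOp_sub_sq_le`). If it diverges, `A_±` is a positive operator dominated by a small
multiple of the identity plus a compact operator, hence compact
(`isCompactOperator_of_re_inner_le`).

Bounded below: with `1/ζ_J(1) = 0` the operator is compact, which excludes a lower bound in infinite
dimension. With `1/ζ_J(1) > 0` the Fredholm alternative reduces the claim to injectivity. If `𝓩 g =
0`, positivity makes the Fourier transform of `g` vanish at the points `log n / 2π`, `n ∈ K`.
Already the products `p^a q^b` of two primes of `Q` give more zeros than a nonzero function of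
exponential type can have (`eq_zero_of_inner_expL2_log_eq_zero`). -/

noncomputable section

/-! ### Exponentials in `L²(I)` and their rank one operators. -/

/-- The exponential `t ↦ e^{ixt}` as a bounded continuous function. -/
def expBCF (x : ℝ) : BoundedContinuousFunction ℝ ℂ :=
  BoundedContinuousFunction.ofNormedAddCommGroup (fun t : ℝ => Complex.exp ((x * t : ℝ) * Complex.I))
    (by fun_prop) 1 (fun t => by rw [Complex.norm_exp_ofReal_mul_I])

lemma expBCF_apply (x t : ℝ) : expBCF x t = Complex.exp ((x * t : ℝ) * Complex.I) := rfl

lemma norm_expBCF_le (x : ℝ) : ‖expBCF x‖ ≤ 1 :=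
  BoundedContinuousFunction.norm_ofNormedAddCommGroup_le _ zero_le_one _

/-- The exponential `t ↦ e^{ixt}` as an element of `L²(I)`. -/
def expL2 (T x : ℝ) : L2Interval T :=
  BoundedContinuousFunction.toLp 2 (volume.restrict (Set.Ioo (-T) T)) ℂ (expBCF x)

lemma coeFn_expL2 (T x : ℝ) :
    expL2 T x =ᵐ[volume.restrict (Set.Ioo (-T) T)] fun t => Complex.exp ((x * t : ℝ) * Complex.I) :=
  BoundedContinuousFunction.coeFn_toLp 2 _ ℂ (expBCF x)

lemma inner_expL2 (T x : ℝ) (g : L2Interval T) :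
    inner ℂ (expL2 T x) g =
      ∫ τ in Set.Ioo (-T) T, Complex.exp (-((x * τ : ℝ) * Complex.I)) * g τ := by
  rw [L2.inner_def]
  apply integral_congr_ae
  filter_upwards [coeFn_expL2 T x] with t ht
  rw [ht, RCLike.inner_apply, ← Complex.exp_conj, mul_comm]
  simp

/-- A constant bounding both the norms and the Lipschitz constant of `x ↦ e^{ixt}` in `L²(I)`. -/
def expConst (T : ℝ) : ℝ :=
  (measureUnivNNReal (volume.restrict (Set.Ioo (-T) T)) : ℝ) ^ ((2 : ℝ≥0∞).toReal⁻¹) * (1 + |T|)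

lemma expConst_nonneg (T : ℝ) : 0 ≤ expConst T := by unfold expConst; positivity

lemma norm_expL2_le (T x : ℝ) : ‖expL2 T x‖ ≤ expConst T := by
  apply Lp.norm_le_of_ae_bound (by positivity)
  filter_upwards [coeFn_expL2 T x] with t ht
  rw [ht, Complex.norm_exp_ofReal_mul_I]
  linarith [abs_nonneg T]

/-- From `|e^{ia} - 1| ≤ |a|` and the boundedness of `I`. This Lipschitz bound is what allows sums
over `log n` to be compared with integrals. -/
lemma norm_expL2_sub_le (T x y : ℝ) :
    ‖expL2 T x - expL2 T y‖ ≤ expConst T * |x - y| := by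
  rw [expConst, mul_assoc]
  apply Lp.norm_le_of_ae_bound (by positivity)
  filter_upwards [coeFn_expL2 T x, coeFn_expL2 T y, Lp.coeFn_sub (expL2 T x) (expL2 T y),
    ae_restrict_mem measurableSet_Ioo] with t hx hy hxy ht
  rw [hxy, Pi.sub_apply, hx, hy]
  have h1 : Complex.exp ((x * t : ℝ) * Complex.I) - Complex.exp ((y * t : ℝ) * Complex.I)
      = Complex.exp ((y * t : ℝ) * Complex.I) *
        (Complex.exp (Complex.I * (((x - y) * t : ℝ) : ℂ)) - 1) := by
    rw [mul_sub, ← Complex.exp_add, mul_one]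
    congr 2
    push_cast
    ring
  rw [h1, norm_mul, Complex.norm_exp_ofReal_mul_I, one_mul]
  refine (Real.norm_exp_I_mul_ofReal_sub_one_le).trans ?_
  rw [Real.norm_eq_abs, abs_mul, mul_comm]
  have : |t| ≤ |T| := by
    rw [abs_le]
    have := le_abs_self T
    constructor <;> linarith [ht.1, ht.2]
  gcongr
  linarith

/-- The rank one operator `g ↦ ⟨e^{ixt}, g⟩ e^{ixt}` on `L²(I)`. -/
def expOp (T x : ℝ) : L2Interval T →L[ℂ] L2Interval T :=
  InnerProductSpace.rankOne ℂ (expL2 T x) (expL2 T x)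

lemma expOp_apply (T x : ℝ) (g : L2Interval T) :
    expOp T x g = inner ℂ (expL2 T x) g • expL2 T x := rfl

lemma inner_expOp (T x : ℝ) (g : L2Interval T) :
    inner ℂ g (expOp T x g) = ((‖inner ℂ (expL2 T x) g‖ ^ 2 : ℝ) : ℂ) := by
  rw [expOp_apply, inner_smul_right, ← inner_conj_symm g (expL2 T x), Complex.mul_conj']
  push_cast
  rfl

lemma norm_expOp_le (T x : ℝ) : ‖expOp T x‖ ≤ expConst T ^ 2 := by
  rw [expOp, InnerProductSpace.norm_rankOne, pow_two]
  have := norm_expL2_le T x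
  have := expConst_nonneg T
  gcongr

lemma norm_expOp_sub_le (T x y : ℝ) :
    ‖expOp T x - expOp T y‖ ≤ 2 * expConst T ^ 2 * |x - y| := by
  have h : expOp T x - expOp T y =
      InnerProductSpace.rankOne ℂ (expL2 T x - expL2 T y) (expL2 T x) +
      InnerProductSpace.rankOne ℂ (expL2 T y) (expL2 T x - expL2 T y) := by
    simp only [expOp, map_sub, sub_apply]
    abel
  rw [h]
  refine (norm_add_le _ _).trans ?_
  rw [InnerProductSpace.norm_rankOne, InnerProductSpace.norm_rankOne]
  have h1 := norm_expL2_sub_le T x y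
  have h2 := norm_expL2_le T x
  have h3 := norm_expL2_le T y
  have h0 := expConst_nonneg T
  calc _ ≤ (expConst T * |x - y|) * expConst T + expConst T * (expConst T * |x - y|) := by gcongr
    _ = _ := by ring

lemma continuous_expOp (T : ℝ) : Continuous (expOp T) := by
  refine (LipschitzWith.of_dist_le_mul
    (K := ⟨2 * expConst T ^ 2, by have := expConst_nonneg T; positivity⟩) fun x y => ?_).continuous
  rw [dist_eq_norm, Real.dist_eq]
  exact norm_expOp_sub_le T x y

lemma isCompactOperator_expOp (T x : ℝ) : IsCompactOperator (expOp T x) := by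
  rw [expOp, InnerProductSpace.rankOne_def']
  have h : IsCompactOperator (innerSL ℂ (expL2 T x)) := 
    isCompactOperator_of_locallyCompactSpace_dom _
  exact h.clm_comp (ContinuousLinearMap.toSpanSingleton ℂ (expL2 T x))

/-! ### Fourier transform and Plancherel on the interval. -/

/-- The extension by zero of an element of `L²(I)` to the real line. -/
def zeroExt {T : ℝ} (g : L2Interval T) : ℝ → ℂ := (Set.Ioo (-T) T).indicator g

lemma memLp_zeroExt {T : ℝ} (g : L2Interval T) : MemLp (zeroExt g) 2 volume :=
  (memLp_indicator_iff_restrict measurableSet_Ioo).2 (Lp.memLp g)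

lemma integrableOn_coe {T : ℝ} (g : L2Interval T) :
    Integrable g (volume.restrict (Set.Ioo (-T) T)) :=
  (Lp.memLp g).integrable (by norm_num)

lemma integrable_zeroExt {T : ℝ} (g : L2Interval T) : Integrable (zeroExt g) volume :=
  (integrable_indicator_iff measurableSet_Ioo).2 (integrableOn_coe g)

lemma fourier_zeroExt {T : ℝ} (g : L2Interval T) (ξ : ℝ) :
    FourierTransform.fourier (zeroExt g) ξ = inner ℂ (expL2 T (2 * Real.pi * ξ)) g := by
  rw [Real.fourier_real_eq_integral_exp_smul, inner_expL2, ← integral_indicator measurableSet_Ioo]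
  congr 1
  ext t
  rw [zeroExt, smul_eq_mul]
  by_cases ht : t ∈ Set.Ioo (-T) T
  · rw [Set.indicator_of_mem ht, Set.indicator_of_mem ht]
    congr 2
    push_cast
    ring
  · rw [Set.indicator_of_notMem ht, Set.indicator_of_notMem ht, mul_zero]

/-- The `L²` transform is not defined by the Fourier integral. The two agree since both satisfy the
multiplication formula `∫ ψ f̂ = ∫ ψ̂ f` against smooth compactly supported `ψ`. -/
lemma fourier_toLp_ae_eq {f : ℝ → ℂ} (hf1 : Integrable f volume) (hf2 : MemLp f 2 volume) :
    (FourierTransform.fourier (hf2.toLp f) : Lp ℂ 2 (volume : Measure ℝ)) =ᵐ[volume]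
      FourierTransform.fourier f := by
  have hcont : Continuous (FourierTransform.fourier f : ℝ → ℂ) :=
    VectorFourier.fourierIntegral_continuous Real.continuous_fourierChar
      (by exact continuous_inner) hf1
  apply ae_eq_of_integral_contDiff_smul_eq
  · exact (Lp.memLp _).locallyIntegrable (by norm_num)
  · exact hcont.locallyIntegrable
  · intro φ hφ hφc
    let ψ : SchwartzMap ℝ ℂ := HasCompactSupport.toSchwartzMap (f := fun x => (φ x : ℂ))
      (hφc.comp_left (g := fun x : ℝ => (x : ℂ)) Complex.ofReal_zero)
      (Complex.ofRealCLM.contDiff.comp hφ)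
    have h1 := congrArg (fun D => D ψ) (Lp.fourier_toTemperedDistribution_eq (hf2.toLp f))
    simp only [TemperedDistribution.fourier_apply, Lp.toTemperedDistribution_apply] at h1
    have hψ : ∀ x, ψ x = (φ x : ℂ) := fun x => rfl
    calc _ = ∫ x, ψ x • (FourierTransform.fourier (hf2.toLp f) : Lp ℂ 2 (volume : Measure ℝ)) x := by
          simp only [hψ, Complex.coe_smul]
      _ = ∫ x, (FourierTransform.fourier ψ) x • (hf2.toLp f) x := h1.symm
      _ = ∫ x, (FourierTransform.fourier (ψ : ℝ → ℂ)) x • f x := by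
          apply integral_congr_ae
          filter_upwards [hf2.coeFn_toLp] with x hx
          rw [hx, SchwartzMap.fourier_coe]
      _ = ∫ x, ψ x • FourierTransform.fourier f x := by
          have := VectorFourier.integral_fourierIntegral_smul_eq_flip (L := innerₗ ℝ) (μ := volume)
            (ν := volume) Real.continuous_fourierChar continuous_inner ψ.integrable hf1
          rw [flip_innerₗ] at this
          exact this
      _ = _ := by simp only [hψ, Complex.coe_smul]

lemma integral_norm_sq_coeFn {α : Type*} [MeasurableSpace α] {μ : Measure α} (f : Lp ℂ 2 μ) :
    ∫ x, ‖f x‖ ^ 2 ∂μ = ‖f‖ ^ 2 := by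
  have h : ((‖f‖ ^ 2 : ℝ) : ℂ) = ∫ x, ((‖f x‖ ^ 2 : ℝ) : ℂ) ∂μ := by
    have := L2.inner_def (𝕜 := ℂ) f f
    rw [inner_self_eq_norm_sq_to_K] at this
    simp only [inner_self_eq_norm_sq_to_K] at this
    simpa using this
  exact Complex.ofReal_injective (h.trans integral_complex_ofReal).symm

lemma plancherel_expL2 {T : ℝ} (g : L2Interval T) :
    Integrable (fun x => ‖inner ℂ (expL2 T x) g‖ ^ 2) volume ∧
    ∫ x, ‖inner ℂ (expL2 T x) g‖ ^ 2 = 2 * Real.pi * ‖g‖ ^ 2 := by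
  have hm := memLp_zeroExt g
  have hae := fourier_toLp_ae_eq (integrable_zeroExt g) hm
  have hF : MemLp (FourierTransform.fourier (zeroExt g) : ℝ → ℂ) 2 volume :=
    (memLp_congr_ae hae).1 (Lp.memLp _)
  have hI : ∫ ξ, ‖FourierTransform.fourier (zeroExt g) ξ‖ ^ 2 = ‖g‖ ^ 2 := by
    calc _ = ∫ ξ, ‖(FourierTransform.fourier (hm.toLp _) : Lp ℂ 2 (volume : Measure ℝ)) ξ‖ ^ 2 := by
          apply integral_congr_ae
          filter_upwards [hae] with x hx
          rw [hx]
      _ = ‖hm.toLp _‖ ^ 2 := by rw [integral_norm_sq_coeFn, Lp.norm_fourier_eq]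
      _ = ∫ x, ‖zeroExt g x‖ ^ 2 := by
          rw [← integral_norm_sq_coeFn]
          apply integral_congr_ae
          filter_upwards [hm.coeFn_toLp] with x hx
          rw [hx]
      _ = ∫ x in Set.Ioo (-T) T, ‖g x‖ ^ 2 := by
          rw [← integral_indicator measurableSet_Ioo]
          congr 1
          ext x
          by_cases hx : x ∈ Set.Ioo (-T) T <;> simp [zeroExt, hx]
      _ = _ := integral_norm_sq_coeFn g
  have hint := hF.integrable_norm_pow (by norm_num)
  have hpi : (2 * Real.pi) ≠ 0 := by positivity
  constructor
  · rw [← integrable_comp_mul_left_iff _ hpi]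
    simpa only [fourier_zeroExt] using! hint
  · simp only [fourier_zeroExt] at hI
    rw [Measure.integral_comp_mul_left (fun x => ‖inner ℂ (expL2 T x) g‖ ^ 2),
      abs_of_pos (by positivity), smul_eq_mul] at hI
    field_simp at hI
    linarith

/-! ### Bessel sequences, weighted frame operators and a compactness criterion. -/

section Bessel

variable {H : Type*} [NormedAddCommGroup H] [InnerProductSpace ℂ H]

/-- `v` is a Bessel sequence with bound `C`. -/
def IsBessel (v : ℕ → H) (C : ℝ) : Prop :=
  0 ≤ C ∧ ∀ (g : H) (N : ℕ), ∑ n ∈ Finset.range N, ‖inner ℂ (v n) g‖ ^ 2 ≤ C * ‖g‖ ^ 2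

namespace IsBessel

variable {v : ℕ → H} {C : ℝ}

lemma sum_le (h : IsBessel v C) (g : H) (s : Finset ℕ) :
    ∑ n ∈ s, ‖inner ℂ (v n) g‖ ^ 2 ≤ C * ‖g‖ ^ 2 := by
  obtain ⟨N, hN⟩ := s.exists_nat_subset_range
  exact (Finset.sum_le_sum_of_subset_of_nonneg hN fun _ _ _ => by positivity).trans (h.2 g N)

lemma summable_sq (h : IsBessel v C) (g : H) : Summable fun n => ‖inner ℂ (v n) g‖ ^ 2 :=
  summable_of_sum_le (fun _ => by positivity) (h.sum_le g)

lemma tsum_sq_le (h : IsBessel v C) (g : H) : ∑' n, ‖inner ℂ (v n) g‖ ^ 2 ≤ C * ‖g‖ ^ 2 :=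
  Real.tsum_le_of_sum_le (fun _ => by positivity) (h.sum_le g)

/-- Duality between analysis and synthesis: expand `‖u‖²` as a sum of `conj(aₙ) ⟨vₙ, u⟩`, apply
Cauchy–Schwarz and the Bessel bound for `u`, then divide by `‖u‖²`. -/
lemma norm_sum_smul_sq_le (h : IsBessel v C) (s : Finset ℕ) (a : ℕ → ℂ) :
    ‖∑ n ∈ s, a n • v n‖ ^ 2 ≤ C * ∑ n ∈ s, ‖a n‖ ^ 2 := by
  set u := ∑ n ∈ s, a n • v n with hu
  have h1 : ‖u‖ ^ 2 ≤ ∑ n ∈ s, ‖a n‖ * ‖inner ℂ (v n) u‖ := by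
    have h2 : ((‖u‖ ^ 2 : ℝ) : ℂ) = ∑ n ∈ s, (starRingEnd ℂ) (a n) * inner ℂ (v n) u := by
      have : inner ℂ u u = ((‖u‖ ^ 2 : ℝ) : ℂ) := by
        rw [inner_self_eq_norm_sq_to_K]
        push_cast
        rfl
      rw [← this]
      conv_lhs => rw [hu, sum_inner]
      simp only [inner_smul_left]
      rfl
    have h3 : ‖u‖ ^ 2 = ‖((‖u‖ ^ 2 : ℝ) : ℂ)‖ := by
      rw [Complex.norm_real, Real.norm_of_nonneg (by positivity)]
    rw [h3, h2]
    refine (norm_sum_le _ _).trans (le_of_eq ?_)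
    simp
  have h4 := Finset.sum_mul_sq_le_sq_mul_sq s (fun n => ‖a n‖) (fun n => ‖inner ℂ (v n) u‖)
  have h5 := h.sum_le u s
  have h6 : (0 : ℝ) ≤ ∑ n ∈ s, ‖a n‖ ^ 2 := Finset.sum_nonneg fun _ _ => by positivity
  have h7 : (‖u‖ ^ 2) ^ 2 ≤ (C * ∑ n ∈ s, ‖a n‖ ^ 2) * ‖u‖ ^ 2 := by
    calc (‖u‖ ^ 2) ^ 2 ≤ (∑ n ∈ s, ‖a n‖ * ‖inner ℂ (v n) u‖) ^ 2 := by gcongr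
      _ ≤ _ := h4
      _ ≤ (∑ n ∈ s, ‖a n‖ ^ 2) * (C * ‖u‖ ^ 2) := by gcongr
      _ = _ := by ring
  rcases eq_or_ne (‖u‖ ^ 2) 0 with h8 | h8
  · rw [h8]
    exact mul_nonneg h.1 h6
  · have h9 : 0 < ‖u‖ ^ 2 := lt_of_le_of_ne (by positivity) (Ne.symm h8)
    rw [pow_two] at h7
    exact le_of_mul_le_mul_right h7 h9

lemma summable_weight_sq (h : IsBessel v C) {w : ℕ → ℝ} {B : ℝ} (hw : ∀ n, |w n| ≤ B) (g : H) :
    Summable fun n => ‖(w n : ℂ) * inner ℂ (v n) g‖ ^ 2 := by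
  refine Summable.of_nonneg_of_le (fun _ => by positivity) (fun n => ?_)
    ((h.summable_sq g).mul_left (B ^ 2))
  rw [norm_mul, mul_pow, Complex.norm_real, Real.norm_eq_abs]
  have := hw n
  gcongr

lemma summable_weight_mul_sq (h : IsBessel v C) {w : ℕ → ℝ} (hw : ∀ n, |w n| ≤ 1) (g : H) :
    Summable fun n => w n * ‖inner ℂ (v n) g‖ ^ 2 := by
  refine Summable.of_norm_bounded (h.summable_sq g) (fun n => ?_)
  rw [norm_mul, Real.norm_eq_abs, Real.norm_of_nonneg (by positivity)]
  exact mul_le_of_le_one_left (by positivity) (hw n)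

variable [CompleteSpace H]

lemma summable_smul (h : IsBessel v C) {a : ℕ → ℂ} (ha : Summable fun n => ‖a n‖ ^ 2) :
    Summable fun n => a n • v n := by
  rw [summable_iff_vanishing_norm] at ha ⊢
  intro ε hε
  obtain ⟨s, hs⟩ := ha (ε ^ 2 / (C + 1)) (div_pos (by positivity) (by linarith [h.1]))
  refine ⟨s, fun t ht => ?_⟩
  have h1 := hs t ht
  have h2 : (0 : ℝ) ≤ ∑ n ∈ t, ‖a n‖ ^ 2 := Finset.sum_nonneg fun _ _ => by positivity
  rw [Real.norm_of_nonneg h2, lt_div_iff₀ (by linarith [h.1])] at h1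
  have h3 := h.norm_sum_smul_sq_le t a
  exact lt_of_pow_lt_pow_left₀ 2 hε.le (by nlinarith)

lemma norm_tsum_smul_sq_le (h : IsBessel v C) {a : ℕ → ℂ} (ha : Summable fun n => ‖a n‖ ^ 2) :
    ‖∑' n, a n • v n‖ ^ 2 ≤ C * ∑' n, ‖a n‖ ^ 2 := by
  have h1 : Tendsto (fun s : Finset ℕ => ‖∑ n ∈ s, a n • v n‖ ^ 2) atTop
      (𝓝 (‖∑' n, a n • v n‖ ^ 2)) := ((h.summable_smul ha).hasSum.norm).pow 2
  have h2 : Tendsto (fun s : Finset ℕ => C * ∑ n ∈ s, ‖a n‖ ^ 2) atTop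
      (𝓝 (C * ∑' n, ‖a n‖ ^ 2)) := ha.hasSum.const_mul C
  exact le_of_tendsto_of_tendsto' h1 h2 fun s => h.norm_sum_smul_sq_le s a

/-- The weighted frame operator `g ↦ ∑ₙ wₙ ⟨vₙ, g⟩ vₙ` of a Bessel sequence. -/
def frameOp (h : IsBessel v C) (w : ℕ → ℝ) (hw : ∀ n, |w n| ≤ 1) : H →L[ℂ] H :=
  LinearMap.mkContinuous
    { toFun := fun g => ∑' n, ((w n : ℂ) * inner ℂ (v n) g) • v n
      map_add' := fun f g => by
        rw [← (h.summable_smul (h.summable_weight_sq hw f)).tsum_add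
          (h.summable_smul (h.summable_weight_sq hw g))]
        congr 1
        ext n
        rw [inner_add_right, mul_add, add_smul]
      map_smul' := fun c g => by
        rw [RingHom.id_apply, ← (h.summable_smul (h.summable_weight_sq hw g)).tsum_const_smul]
        congr 1
        ext n
        rw [inner_smul_right, smul_smul]
        congr 1
        ring } C (fun g => by
    have h1 := h.norm_tsum_smul_sq_le (h.summable_weight_sq hw g)
    have h2 : ∑' n, ‖(w n : ℂ) * inner ℂ (v n) g‖ ^ 2 ≤ ∑' n, ‖inner ℂ (v n) g‖ ^ 2 := by
      refine (h.summable_weight_sq hw g).tsum_le_tsum (fun n => ?_) (h.summable_sq g)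
      rw [norm_mul, Complex.norm_real, Real.norm_eq_abs]
      have := hw n
      calc (|w n| * ‖inner ℂ (v n) g‖) ^ 2 ≤ (1 * ‖inner ℂ (v n) g‖) ^ 2 := by gcongr
        _ = _ := by rw [one_mul]
    have h3 := h.tsum_sq_le g
    have h0 := h.1
    refine le_of_sq_le_sq ?_ (by positivity)
    calc _ ≤ C * ∑' n, ‖(w n : ℂ) * inner ℂ (v n) g‖ ^ 2 := h1
      _ ≤ C * (C * ‖g‖ ^ 2) := by gcongr; exact h2.trans h3
      _ = _ := by ring)

lemma hasSum_frameOp (h : IsBessel v C) (w : ℕ → ℝ) (hw : ∀ n, |w n| ≤ 1) (g : H) :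
    HasSum (fun n => ((w n : ℂ) * inner ℂ (v n) g) • v n) (h.frameOp w hw g) :=
  (h.summable_smul (h.summable_weight_sq hw g)).hasSum

lemma inner_frameOp (h : IsBessel v C) (w : ℕ → ℝ) (hw : ∀ n, |w n| ≤ 1) (g : H) :
    inner ℂ g (h.frameOp w hw g) = ((∑' n, w n * ‖inner ℂ (v n) g‖ ^ 2 : ℝ) : ℂ) := by
  have h1 := (h.hasSum_frameOp w hw g).mapL (innerSL ℂ g)
  have h2 : HasSum (fun n => ((w n * ‖inner ℂ (v n) g‖ ^ 2 : ℝ) : ℂ))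
      ((∑' n, w n * ‖inner ℂ (v n) g‖ ^ 2 : ℝ) : ℂ) :=
    Complex.hasSum_ofReal.2 (h.summable_weight_mul_sq hw g).hasSum
  have h3 : (fun n => innerSL ℂ g (((w n : ℂ) * inner ℂ (v n) g) • v n)) =
      fun n => ((w n * ‖inner ℂ (v n) g‖ ^ 2 : ℝ) : ℂ) := by
    ext n
    rw [innerSL_apply_apply, inner_smul_right, ← inner_conj_symm g (v n), mul_assoc, Complex.mul_conj']
    push_cast
    rfl
  rw [← h3] at h2
  exact h1.unique h2

lemma norm_frameOp_sub_sq_le (h : IsBessel v C) {w w' : ℕ → ℝ} (hw : ∀ n, |w n| ≤ 1)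
    (hw' : ∀ n, |w' n| ≤ 1) (g : H) :
    ‖h.frameOp w hw g - h.frameOp w' hw' g‖ ^ 2 ≤
      C * ∑' n, (w n - w' n) ^ 2 * ‖inner ℂ (v n) g‖ ^ 2 := by
  have h1 := (h.hasSum_frameOp w hw g).sub (h.hasSum_frameOp w' hw' g)
  have h2 : ∀ n, ((w n : ℂ) * inner ℂ (v n) g) • v n - ((w' n : ℂ) * inner ℂ (v n) g) • v n =
      (((w n - w' n : ℝ) : ℂ) * inner ℂ (v n) g) • v n := by
    intro n
    rw [← sub_smul, ← sub_mul]
    push_cast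
    rfl
  simp only [h2] at h1
  have hB : ∀ n, |w n - w' n| ≤ 2 := fun n => by
    have := abs_sub (w n) (w' n)
    linarith [hw n, hw' n]
  rw [← h1.tsum_eq]
  refine (h.norm_tsum_smul_sq_le (h.summable_weight_sq hB g)).trans (le_of_eq ?_)
  congr 2
  ext n
  rw [norm_mul, mul_pow, Complex.norm_real, Real.norm_eq_abs, sq_abs]

/-- Uses `w² ≤ w` for `0 ≤ w ≤ 1`. The right side is `C ⟨g, Zg⟩`, the form required by
`isCompactOperator_of_re_inner_le`. -/
lemma norm_frameOp_sq_le (h : IsBessel v C) {w : ℕ → ℝ} (hw : ∀ n, |w n| ≤ 1)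
    (hw0 : ∀ n, 0 ≤ w n) (g : H) :
    ‖h.frameOp w hw g‖ ^ 2 ≤ C * ∑' n, w n * ‖inner ℂ (v n) g‖ ^ 2 := by
  refine (h.norm_tsum_smul_sq_le (h.summable_weight_sq hw g)).trans ?_
  refine mul_le_mul_of_nonneg_left ?_ h.1
  refine (h.summable_weight_sq hw g).tsum_le_tsum (fun n => ?_) (h.summable_weight_mul_sq hw g)
  rw [norm_mul, mul_pow, Complex.norm_real, Real.norm_eq_abs, sq_abs]
  have := (le_abs_self _).trans (hw n)
  have := hw0 n
  gcongr
  nlinarith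

/-- Dominated convergence in the Bessel sum, with majorant `4 |⟨vₙ, g⟩|²`; the convergence is only
strong. -/
lemma tendsto_frameOp (h : IsBessel v C) {ι : Type*} {l : Filter ι} {W : ι → ℕ → ℝ} {w : ℕ → ℝ}
    (hW : ∀ i n, |W i n| ≤ 1) (hw : ∀ n, |w n| ≤ 1)
    (hlim : ∀ n, Tendsto (fun i => W i n) l (𝓝 (w n))) (g : H) :
    Tendsto (fun i => h.frameOp (W i) (hW i) g) l (𝓝 (h.frameOp w hw g)) := by
  rw [tendsto_iff_norm_sub_tendsto_zero]
  have h1 : Tendsto (fun i => ∑' n, (W i n - w n) ^ 2 * ‖inner ℂ (v n) g‖ ^ 2) l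
      (𝓝 (∑' _ : ℕ, (0 : ℝ))) := by
    refine tendsto_tsum_of_dominated_convergence ((h.summable_sq g).mul_left 4) (fun n => ?_)
      (Eventually.of_forall fun i n => ?_)
    · have := (((hlim n).sub_const (w n)).pow 2).mul_const (‖inner ℂ (v n) g‖ ^ 2)
      simpa using this
    · rw [norm_mul, Real.norm_of_nonneg (by positivity), Real.norm_of_nonneg (by positivity)]
      gcongr
      have := abs_le.1 (hW i n)
      have := abs_le.1 (hw n)
      nlinarith
  rw [tsum_zero] at h1
  have h2 : Tendsto (fun i => ‖h.frameOp (W i) (hW i) g - h.frameOp w hw g‖ ^ 2) l (𝓝 0) := by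
    refine squeeze_zero (fun _ => by positivity) (fun i => h.norm_frameOp_sub_sq_le (hW i) hw g) ?_
    simpa using h1.const_mul C
  have h3 := h2.sqrt
  simpa [Real.sqrt_sq] using h3

end IsBessel

/-- A finite net for the image of the unit ball under `K` lifts to points whose images under `Z`
form a net: if `K (g - x')` is small then so is the form of `Z` at `g - x'`, and the form controls
`‖Z (g - x')‖²`. -/
lemma isCompactOperator_of_re_inner_le [CompleteSpace H] {Z : H →L[ℂ] H} {C : ℝ} (hC : 0 ≤ C)
    (hZ : ∀ g, ‖Z g‖ ^ 2 ≤ C * (inner ℂ g (Z g)).re)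
    (hK : ∀ ε > 0, ∃ K : H →L[ℂ] H, IsCompactOperator K ∧
      ∀ g, (inner ℂ g (Z g)).re ≤ ε * ‖g‖ ^ 2 + (inner ℂ g (K g)).re) :
    IsCompactOperator Z := by
  have key : TotallyBounded (Z '' Metric.closedBall 0 1) := by
    rw [Metric.totallyBounded_iff]
    intro ε hε
    -- With `‖g - x'‖ ≤ 2`, the form of `Z` at `g - x'` is at most `4η + 2η`. The `+ 1` gives the
    -- strict inequality `6Cη < ε²` and covers `C = 0`.
    set η := ε ^ 2 / (6 * C + 1) with hη
    have hη0 : 0 < η := by positivity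
    obtain ⟨K, hKc, hKle⟩ := hK η hη0
    have hKb : TotallyBounded (K '' Metric.closedBall 0 1) :=
      (hKc.isCompact_closure_image_closedBall (f := (K : H →ₗ[ℂ] H)) 1).totallyBounded.subset
        subset_closure
    obtain ⟨t, hts, htf, htc⟩ := Metric.finite_approx_of_totallyBounded hKb η hη0
    -- One preimage in the ball is chosen for each point of the net, so that `t'` is finite.
    obtain ⟨t', ht's, ht'⟩ := Set.exists_subset_bijOn (Metric.closedBall 0 1 ∩ K ⁻¹' t) K
    have ht'f : t'.Finite := by
      apply Set.Finite.of_finite_image _ ht'.injOn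
      refine htf.subset ?_
      rw [ht'.image_eq]
      rintro _ ⟨x, hx, rfl⟩
      exact hx.2
    refine ⟨Z '' t', ht'f.image _, ?_⟩
    rintro _ ⟨g, hg, rfl⟩
    obtain ⟨y, hy, hgy⟩ := Set.mem_iUnion₂.1 (htc ⟨g, hg, rfl⟩)
    obtain ⟨x, hx, rfl⟩ := hts hy
    have : K x ∈ K '' (Metric.closedBall 0 1 ∩ K ⁻¹' t) := ⟨x, ⟨hx, hy⟩, rfl⟩
    rw [← ht'.image_eq] at this
    obtain ⟨x', hx', hxx'⟩ := this
    have hx'b := (ht's hx').1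
    refine Set.mem_iUnion₂.2 ⟨Z x', ⟨x', hx', rfl⟩, ?_⟩
    rw [Metric.mem_ball, dist_eq_norm, ← map_sub] at hgy ⊢
    simp only [Metric.mem_closedBall, dist_zero_right] at hg hx'b
    rw [map_sub, ← hxx', ← map_sub] at hgy
    have hn : ‖g - x'‖ ≤ 2 := (norm_sub_le _ _).trans (by linarith)
    have h1 := hZ (g - x')
    have h2 := hKle (g - x')
    have h3 : (inner ℂ (g - x') (K (g - x'))).re ≤ 2 * η := by
      refine (Complex.re_le_norm _).trans ((norm_inner_le_norm _ _).trans ?_)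
      gcongr
    have h4 : ‖g - x'‖ ^ 2 ≤ 2 ^ 2 := by gcongr
    have h5 : (inner ℂ (g - x') (Z (g - x'))).re ≤ 6 * η := by nlinarith
    have h6 : C * (6 * η) < ε ^ 2 := by
      rw [hη, ← mul_div_assoc, ← mul_div_assoc, div_lt_iff₀ (by positivity)]
      nlinarith [sq_nonneg ε, hε]
    exact lt_of_pow_lt_pow_left₀ 2 hε.le ((h1.trans (mul_le_mul_of_nonneg_left h5 hC)).trans_lt h6)
  have := key.closure.isCompact_of_isClosed isClosed_closure
  exact (isCompactOperator_iff_isCompact_closure_image_closedBall (Z : H →ₗ[ℂ] H) one_pos).2 this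

end Bessel

/-! ### Integrals of operators and comparison of a sum with an integral. -/

section Integral

variable {H : Type*} [NormedAddCommGroup H] [NormedSpace ℂ H] [CompleteSpace H]

/-- The average of compact operators stays in the closed convex set of compact operators; the
integral is a multiple of it. -/
lemma isCompactOperator_intervalIntegral {f : ℝ → H →L[ℂ] H} (hf : Continuous f)
    (hc : ∀ x, IsCompactOperator (f x)) {a b : ℝ} (hab : a < b) :
    IsCompactOperator (∫ x in a..b, f x : H →L[ℂ] H) := by
  have hmem : (⨍ x in a..b, f x) ∈ ((compactOperator (RingHom.id ℂ) H H).restrictScalars ℝ :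
      Set (H →L[ℂ] H)) := by
    rw [Set.uIoc_of_le hab.le]
    refine Convex.set_average_mem (Submodule.convex _) isClosed_setOfPred_isCompactOperator ?_ ?_
      (Eventually.of_forall hc) ?_
    · simp [hab]
    · simp
    · exact (hf.intervalIntegrable a b).1
  rw [interval_average_eq] at hmem
  have h2 := Submodule.smul_mem _ (b - a) hmem
  rw [smul_smul, mul_inv_cancel₀ (sub_pos.2 hab).ne', one_smul] at h2
  exact h2

/-- The interval has length `log (1 + 1/m) = 1/m + O(1/m²)`, and on it `f` varies by at most `L/m`;
each error is `O(1/m²)`. -/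
lemma norm_inv_smul_sub_integral_le {E : Type*} [NormedAddCommGroup E] [NormedSpace ℝ E]
    [CompleteSpace E] {f : ℝ → E} (hf : Continuous f) {B L : ℝ} (hL : 0 ≤ L)
    (hfB : ∀ x, ‖f x‖ ≤ B) (hfL : ∀ x y, ‖f x - f y‖ ≤ L * |x - y|) {m : ℝ} (hm : 1 ≤ m) :
    ‖m⁻¹ • f (Real.log m) - ∫ x in Real.log m..Real.log (m + 1), f x‖ ≤ (B + L) * (1 / m ^ 2) := by
  have hm0 : 0 < m := by linarith
  set d := Real.log (m + 1) - Real.log m with hd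
  have hdl : d = Real.log (1 + m⁻¹) := by
    rw [hd, ← Real.log_div (by positivity) hm0.ne']
    congr 1
    field_simp
  have hd0 : 0 ≤ d := by
    rw [hdl]
    exact Real.log_nonneg (by have : 0 < m⁻¹ := by positivity
                              linarith)
  have hd1 : d ≤ m⁻¹ := by
    rw [hdl]
    have := Real.log_le_sub_one_of_pos (show 0 < 1 + m⁻¹ by positivity)
    linarith
  have hd2 : m⁻¹ - d ≤ 1 / m ^ 2 := by
    rw [hdl]
    have h1 := Real.one_sub_inv_le_log_of_pos (show 0 < 1 + m⁻¹ by positivity)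
    have h2 : m⁻¹ - (1 - (1 + m⁻¹)⁻¹) ≤ 1 / m ^ 2 := by
      have : m⁻¹ - (1 - (1 + m⁻¹)⁻¹) = 1 / (m * (m + 1)) := by
        field_simp
        ring
      rw [this]
      gcongr
      nlinarith
    linarith
  have hsplit : m⁻¹ • f (Real.log m) - ∫ x in Real.log m..Real.log (m + 1), f x =
      (m⁻¹ - d) • f (Real.log m) +
        ∫ x in Real.log m..Real.log (m + 1), (f (Real.log m) - f x) := by
    rw [intervalIntegral.integral_sub (by simp) (hf.intervalIntegrable _ _),
      intervalIntegral.integral_const, sub_smul]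
    abel
  rw [hsplit]
  have hlog : Real.log m ≤ Real.log (m + 1) := by linarith
  have h3 : ‖∫ x in Real.log m..Real.log (m + 1), (f (Real.log m) - f x)‖ ≤
      (L * d) * |Real.log (m + 1) - Real.log m| := by
    refine intervalIntegral.norm_integral_le_of_norm_le_const fun x hx => ?_
    rw [Set.uIoc_of_le hlog] at hx
    refine (hfL _ _).trans ?_
    gcongr
    rw [abs_le]
    constructor <;> linarith [hx.1, hx.2]
  rw [← hd, abs_of_nonneg hd0] at h3
  have h4 : ‖(m⁻¹ - d) • f (Real.log m)‖ ≤ (1 / m ^ 2) * B := by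
    rw [norm_smul, Real.norm_of_nonneg (by linarith)]
    have := hfB (Real.log m)
    gcongr
  have h5 : L * d * d ≤ L * (1 / m ^ 2) := by
    have : d * d ≤ m⁻¹ * m⁻¹ := by gcongr
    have h : m⁻¹ * m⁻¹ = 1 / m ^ 2 := by field_simp
    rw [mul_assoc]
    gcongr
    linarith
  refine (norm_add_le _ _).trans ?_
  linarith

end Integral

/-! ### The sum over all integers: Bessel bound and comparison with the identity. -/

lemma summable_one_div_succ_sq : Summable fun n : ℕ => 1 / ((n : ℝ) + 1) ^ 2 := by
  have := (summable_nat_add_iff 1).2 (Real.summable_one_div_nat_pow.2 (by norm_num : 1 < 2))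
  simpa using this

/-- The vectors `n^{-1/2} e^{iσ(log n + y)t}` in `L²(I)`. -/
def logVec (T σ y : ℝ) (n : ℕ) : L2Interval T :=
  (((Real.sqrt n)⁻¹ : ℝ) : ℂ) • expL2 T (σ * (Real.log n + y))

lemma norm_inner_logVec_sq (T σ y : ℝ) (n : ℕ) (g : L2Interval T) :
    ‖inner ℂ (logVec T σ y n) g‖ ^ 2 =
      (n : ℝ)⁻¹ * ‖inner ℂ (expL2 T (σ * (Real.log n + y))) g‖ ^ 2 := by
  rw [logVec, inner_smul_left, Complex.conj_ofReal, norm_mul, mul_pow, Complex.norm_real,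
    Real.norm_eq_abs, sq_abs, inv_pow, Real.sq_sqrt n.cast_nonneg]

lemma inner_logVec_smul (T σ y : ℝ) (n : ℕ) (g : L2Interval T) :
    (inner ℂ (logVec T σ y n) g) • logVec T σ y n =
      (n : ℝ)⁻¹ • expOp T (σ * (Real.log n + y)) g := by
  rw [logVec, inner_smul_left, Complex.conj_ofReal, smul_smul, expOp_apply,
    RCLike.real_smul_eq_coe_smul (K := ℂ), smul_smul, mul_right_comm, ← Complex.ofReal_mul,
    ← mul_inv, Real.mul_self_sqrt n.cast_nonneg]
  rfl

/-- The difference between a weighted rank one operator at `log (n + 1)` and the integral of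
such operators over `[log (n + 1), log (n + 2)]`. -/
def logDefect (T σ y : ℝ) (n : ℕ) : L2Interval T →L[ℂ] L2Interval T :=
  ((n : ℝ) + 1)⁻¹ • expOp T (σ * (Real.log ((n : ℝ) + 1) + y)) -
    ∫ x in Real.log ((n : ℝ) + 1)..Real.log ((n : ℝ) + 1 + 1), expOp T (σ * (x + y))

lemma continuous_expOp_affine (T σ y : ℝ) : Continuous fun x => expOp T (σ * (x + y)) :=
  (continuous_expOp T).comp (by fun_prop)

lemma norm_logDefect_le (T y : ℝ) {σ : ℝ} (hσ : |σ| = 1) (n : ℕ) :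
    ‖logDefect T σ y n‖ ≤ (3 * expConst T ^ 2) * (1 / ((n : ℝ) + 1) ^ 2) := by
  have := norm_inv_smul_sub_integral_le (continuous_expOp_affine T σ y)
    (B := expConst T ^ 2) (L := 2 * expConst T ^ 2) (by positivity)
    (fun x => norm_expOp_le T _)
    (fun x z => by
      refine (norm_expOp_sub_le T _ _).trans (le_of_eq ?_)
      rw [← mul_sub, abs_mul, hσ, one_mul, add_sub_add_right_eq_sub])
    (m := (n : ℝ) + 1) (by linarith [n.cast_nonneg (α := ℝ)])
  refine this.trans (le_of_eq ?_)
  ring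

lemma isCompactOperator_logDefect (T σ y : ℝ) (n : ℕ) : IsCompactOperator (logDefect T σ y n) := by
  have h1 : IsCompactOperator
      (((n : ℝ) + 1)⁻¹ • expOp T (σ * (Real.log ((n : ℝ) + 1) + y)) :
        L2Interval T →L[ℂ] L2Interval T) :=
    (isCompactOperator_expOp T _).smul ((n : ℝ) + 1)⁻¹
  refine h1.sub (isCompactOperator_intervalIntegral (continuous_expOp_affine T σ y)
    (fun x => isCompactOperator_expOp _ _) ?_)
  exact Real.log_lt_log (by positivity) (by linarith)

lemma summable_logDefect (T y : ℝ) {σ : ℝ} (hσ : |σ| = 1) : Summable (logDefect T σ y) :=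
  Summable.of_norm_bounded (summable_one_div_succ_sq.mul_left _) (norm_logDefect_le T y hσ)

lemma isCompactOperator_of_hasSum {H : Type*} [NormedAddCommGroup H] [NormedSpace ℂ H]
    [CompleteSpace H] {f : ℕ → H →L[ℂ] H} {S : H →L[ℂ] H} (hf : HasSum f S)
    (hc : ∀ n, IsCompactOperator (f n)) : IsCompactOperator S := by
  refine isCompactOperator_of_tendsto hf (Eventually.of_forall fun s => ?_)
  exact Submodule.sum_mem (compactOperator (RingHom.id ℂ) H H) fun n _ => hc n

/-- The intervals `[log (n + 1), log (n + 2)]` tile `[0, log (N + 1)]`, so the integrals hidden in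
the defects add up to a single one. -/
lemma sum_inner_logVec (T σ y : ℝ) (N : ℕ) (g : L2Interval T) :
    ((∑ n ∈ Finset.range N, ‖inner ℂ (logVec T σ y (n + 1)) g‖ ^ 2 : ℝ) : ℂ) =
      inner ℂ g ((∑ n ∈ Finset.range N, logDefect T σ y n) g) +
      ((∫ x in (0 : ℝ)..Real.log ((N : ℝ) + 1),
        ‖inner ℂ (expL2 T (σ * (x + y))) g‖ ^ 2 : ℝ) : ℂ) := by
  have h1 : ∑ n ∈ Finset.range N, logDefect T σ y n =
      ∑ n ∈ Finset.range N, ((n : ℝ) + 1)⁻¹ • expOp T (σ * (Real.log ((n : ℝ) + 1) + y)) -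
      ∫ x in (0 : ℝ)..Real.log ((N : ℝ) + 1), expOp T (σ * (x + y)) := by
    have := intervalIntegral.sum_integral_adjacent_intervals (μ := volume) (n := N)
      (a := fun n : ℕ => Real.log ((n : ℝ) + 1)) (f := fun x => expOp T (σ * (x + y)))
      fun n _ => (continuous_expOp_affine T σ y).intervalIntegrable _ _
    simp only [Nat.cast_zero, zero_add, Real.log_one] at this
    rw [← this, ← Finset.sum_sub_distrib]
    simp only [logDefect, Nat.cast_add, Nat.cast_one]
  let Λ : (L2Interval T →L[ℂ] L2Interval T) →L[ℂ] ℂ :=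
    (innerSL ℂ g).comp (ContinuousLinearMap.apply ℂ (L2Interval T) g)
  have hΛ : ∀ S, Λ S = inner ℂ g (S g) := fun S => rfl
  have h2 : Λ (∫ x in (0 : ℝ)..Real.log ((N : ℝ) + 1), expOp T (σ * (x + y))) =
      ((∫ x in (0 : ℝ)..Real.log ((N : ℝ) + 1),
        ‖inner ℂ (expL2 T (σ * (x + y))) g‖ ^ 2 : ℝ) : ℂ) := by
    rw [← Λ.intervalIntegral_comp_comm ((continuous_expOp_affine T σ y).intervalIntegrable _ _),
      ← intervalIntegral.integral_ofReal]
    simp only [hΛ, inner_expOp]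
  rw [← h2, ← hΛ, h1, map_sub, sub_add_cancel, map_sum]
  push_cast
  refine Finset.sum_congr rfl fun n _ => ?_
  rw [hΛ, smul_apply, RCLike.real_smul_eq_coe_smul (K := ℂ), inner_smul_right, inner_expOp]
  have := norm_inner_logVec_sq T σ y (n + 1) g
  rw [← Complex.ofReal_pow, this]
  push_cast
  rfl

lemma integrable_inner_expL2_affine {T y : ℝ} {σ : ℝ} (hσ : |σ| = 1) (g : L2Interval T) :
    Integrable (fun x => ‖inner ℂ (expL2 T (σ * (x + y))) g‖ ^ 2) volume := by
  have h0 : σ ≠ 0 := by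
    rintro rfl
    simp at hσ
  have h1 := ((plancherel_expL2 g).1.comp_mul_left' h0).comp_add_right y
  exact h1

lemma integral_inner_expL2_affine {T y : ℝ} {σ : ℝ} (hσ : |σ| = 1) (g : L2Interval T) :
    ∫ x, ‖inner ℂ (expL2 T (σ * (x + y))) g‖ ^ 2 = 2 * Real.pi * ‖g‖ ^ 2 := by
  rw [integral_add_right_eq_self (fun x => ‖inner ℂ (expL2 T (σ * x)) g‖ ^ 2) y,
    Measure.integral_comp_mul_left (fun x => ‖inner ℂ (expL2 T x) g‖ ^ 2), abs_inv, hσ, inv_one,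
    one_smul, (plancherel_expL2 g).2]

/-- A Bessel bound for the sequences `logVec`. -/
def besselConst (T : ℝ) : ℝ :=
  3 * expConst T ^ 2 * (∑' n : ℕ, 1 / ((n : ℝ) + 1) ^ 2) + 2 * Real.pi

/-- The defects are norm summable and the remaining integral is at most its value `2π ‖g‖²` over the
whole line. The bound does not depend on the shift `y`; this uniformity is used with `y = log p` for
multiples of `p`. -/
lemma isBessel_logVec (T y : ℝ) {σ : ℝ} (hσ : |σ| = 1) :
    IsBessel (logVec T σ y) (besselConst T) := by
  have hS0 : 0 ≤ ∑' n : ℕ, 1 / ((n : ℝ) + 1) ^ 2 := tsum_nonneg fun n => by positivity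
  have hpi := Real.pi_pos
  refine ⟨by unfold besselConst; positivity, fun g N => ?_⟩
  -- The vector of index `0` vanishes since `(√0)⁻¹ = 0`, so the index can be shifted by one.
  have h1 : ∑ n ∈ Finset.range N, ‖inner ℂ (logVec T σ y n) g‖ ^ 2 ≤
      ∑ n ∈ Finset.range N, ‖inner ℂ (logVec T σ y (n + 1)) g‖ ^ 2 := by
    have h0 : ‖inner ℂ (logVec T σ y 0) g‖ ^ 2 = 0 := by
      rw [norm_inner_logVec_sq]
      simp
    have := Finset.sum_range_succ' (fun n => ‖inner ℂ (logVec T σ y n) g‖ ^ 2) N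
    rw [h0, add_zero, Finset.sum_range_succ] at this
    rw [← this]
    linarith [sq_nonneg ‖inner ℂ (logVec T σ y N) g‖]
  have h2 := congrArg Complex.re (sum_inner_logVec T σ y N g)
  rw [Complex.add_re, Complex.ofReal_re, Complex.ofReal_re] at h2
  have h3 : (inner ℂ g ((∑ n ∈ Finset.range N, logDefect T σ y n) g)).re ≤
      (3 * expConst T ^ 2 * (∑' n : ℕ, 1 / ((n : ℝ) + 1) ^ 2)) * ‖g‖ ^ 2 := by
    refine (Complex.re_le_norm _).trans ((norm_inner_le_norm _ _).trans ?_)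
    have h4 : ‖∑ n ∈ Finset.range N, logDefect T σ y n‖ ≤
        3 * expConst T ^ 2 * (∑' n : ℕ, 1 / ((n : ℝ) + 1) ^ 2) := by
      refine (norm_sum_le_of_le _ fun n _ => norm_logDefect_le T y hσ n).trans ?_
      rw [← Finset.mul_sum]
      gcongr
      exact summable_one_div_succ_sq.sum_le_tsum _ fun n _ => by positivity
    have h5 := (∑ n ∈ Finset.range N, logDefect T σ y n).le_of_opNorm_le h4 g
    calc _ ≤ ‖g‖ * ((3 * expConst T ^ 2 * (∑' n : ℕ, 1 / ((n : ℝ) + 1) ^ 2)) * ‖g‖) := by gcongr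
      _ = _ := by ring
  have h6 : ∫ x in (0 : ℝ)..Real.log ((N : ℝ) + 1), ‖inner ℂ (expL2 T (σ * (x + y))) g‖ ^ 2 ≤
      2 * Real.pi * ‖g‖ ^ 2 := by
    rw [intervalIntegral.integral_of_le
      (Real.log_nonneg (by linarith [N.cast_nonneg (α := ℝ)])), ← integral_inner_expL2_affine hσ g]
    exact setIntegral_le_integral (integrable_inner_expL2_affine hσ g)
      (Eventually.of_forall fun x => by positivity)
  rw [besselConst, add_mul]
  linarith

/-- The operator `g ↦ ∑ₙ (wₙ / n) ⟨e^{iσ t log n}, g⟩ e^{iσ t log n}` on `L²(I)`. -/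
def logFrameOp (T : ℝ) {σ : ℝ} (hσ : |σ| = 1) (w : ℕ → ℝ) (hw : ∀ n, |w n| ≤ 1) :
    L2Interval T →L[ℂ] L2Interval T :=
  (isBessel_logVec T 0 hσ).frameOp w hw

lemma inner_logFrameOp_one (T : ℝ) {σ : ℝ} (hσ : |σ| = 1) (g : L2Interval T) :
    inner ℂ g (logFrameOp T hσ 1 (by simp) g) =
      inner ℂ g ((∑' n, logDefect T σ 0 n) g) +
      ((∫ x in Set.Ioi (0 : ℝ), ‖inner ℂ (expL2 T (σ * x)) g‖ ^ 2 : ℝ) : ℂ) := by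
  have hb := isBessel_logVec T 0 hσ
  rw [logFrameOp, hb.inner_frameOp]
  have h1 : Tendsto (fun N => ((∑ n ∈ Finset.range N, ‖inner ℂ (logVec T σ 0 (n + 1)) g‖ ^ 2 : ℝ) : ℂ))
      atTop (𝓝 ((∑' n, (1 : ℕ → ℝ) n * ‖inner ℂ (logVec T σ 0 n) g‖ ^ 2 : ℝ) : ℂ)) := by
    refine (Complex.continuous_ofReal.tendsto _).comp ?_
    have h0 : ‖inner ℂ (logVec T σ 0 0) g‖ ^ 2 = 0 := by
      rw [norm_inner_logVec_sq]
      simp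
    simp only [Pi.one_apply, one_mul]
    rw [(hb.summable_sq g).tsum_eq_zero_add, h0, zero_add]
    exact ((summable_nat_add_iff 1).2 (hb.summable_sq g)).hasSum.tendsto_sum_nat
  refine tendsto_nhds_unique h1 ?_
  simp only [sum_inner_logVec, add_zero]
  refine Tendsto.add ?_ ((Complex.continuous_ofReal.tendsto _).comp ?_)
  · let Λ : (L2Interval T →L[ℂ] L2Interval T) →L[ℂ] ℂ :=
      (innerSL ℂ g).comp (ContinuousLinearMap.apply ℂ (L2Interval T) g)
    exact (Λ.continuous.tendsto _).comp (summable_logDefect T 0 hσ).hasSum.tendsto_sum_nat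
  · have hint := integrable_inner_expL2_affine (y := 0) hσ g
    simp only [add_zero] at hint
    refine intervalIntegral_tendsto_integral_Ioi 0 hint.integrableOn ?_
    exact Real.tendsto_log_atTop.comp
      (tendsto_atTop_add_const_right _ _ tendsto_natCast_atTop_atTop)

/-- The integrals for `σ = 1` and `σ = -1` cover the two half-lines, and Plancherel evaluates their
sum; the defects make up `R`. -/
lemma logFrameOp_one_add_eq (T : ℝ) :
    ∃ R : L2Interval T →L[ℂ] L2Interval T, IsCompactOperator R ∧
      logFrameOp T (σ := 1) (by simp) 1 (by simp) + logFrameOp T (σ := -1) (by simp) 1 (by simp) =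
        ((2 * Real.pi : ℝ) : ℂ) • ContinuousLinearMap.id ℂ (L2Interval T) + R := by
  have h1 : |(1 : ℝ)| = 1 := by simp
  have h2 : |(-1 : ℝ)| = 1 := by simp
  refine ⟨∑' n, logDefect T 1 0 n + ∑' n, logDefect T (-1) 0 n, ?_, ?_⟩
  · exact (isCompactOperator_of_hasSum (summable_logDefect T 0 h1).hasSum
      (isCompactOperator_logDefect T _ _)).add
      (isCompactOperator_of_hasSum (summable_logDefect T 0 h2).hasSum
      (isCompactOperator_logDefect T _ _))
  · apply ContinuousLinearMap.coe_injective
    -- Over `ℂ` an operator is determined by its quadratic form.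
    rw [← ext_inner_map]
    intro g
    apply (starRingEnd ℂ).injective
    rw [inner_conj_symm, inner_conj_symm]
    simp only [ContinuousLinearMap.coe_coe, add_apply, inner_add_right,
      smul_apply, ContinuousLinearMap.id_apply]
    rw [inner_logFrameOp_one, inner_logFrameOp_one, inner_smul_right, inner_self_eq_norm_sq_to_K]
    have hint := (plancherel_expL2 g).1
    have h3 : ∫ x in Set.Ioi (0 : ℝ), ‖inner ℂ (expL2 T (-1 * x)) g‖ ^ 2 =
        ∫ x in Set.Iic (0 : ℝ), ‖inner ℂ (expL2 T x) g‖ ^ 2 := by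
      have := integral_comp_neg_Ioi 0 (fun x => ‖inner ℂ (expL2 T x) g‖ ^ 2)
      simpa only [neg_one_mul, neg_zero] using this
    have h4 : (∫ x in Set.Ioi (0 : ℝ), ‖inner ℂ (expL2 T (1 * x)) g‖ ^ 2) +
        ∫ x in Set.Ioi (0 : ℝ), ‖inner ℂ (expL2 T (-1 * x)) g‖ ^ 2 = 2 * Real.pi * ‖g‖ ^ 2 := by
      rw [h3, add_comm, ← (plancherel_expL2 g).2]
      simp only [one_mul]
      exact intervalIntegral.integral_Iic_add_Ioi hint.integrableOn hint.integrableOn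
    have h5 := congrArg (fun r : ℝ => (r : ℂ)) h4
    simp only [Complex.ofReal_add, Complex.ofReal_mul, Complex.ofReal_pow] at h5
    simp only [Complex.ofReal_mul, Complex.coe_algebraMap]
    linear_combination h5

/-! ### Abel summation and periodic weights. -/

lemma tendsto_sum_smul_of_bounded_sums {E : Type*} [NormedAddCommGroup E] [NormedSpace ℝ E]
    [CompleteSpace E] {w : ℕ → ℝ} {A : ℕ → E} {M : ℝ}
    (hw : ∀ n, |∑ m ∈ Finset.range n, w m| ≤ M) (hA : Tendsto A atTop (𝓝 0))
    (hs : Summable fun n => ‖A n - A (n + 1)‖) :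
    Summable (fun n => (∑ m ∈ Finset.range (n + 1), w m) • (A n - A (n + 1))) ∧
    Tendsto (fun n => ∑ m ∈ Finset.range n, w m • A m) atTop
      (𝓝 (∑' n, (∑ m ∈ Finset.range (n + 1), w m) • (A n - A (n + 1)))) := by
  have h1 : Summable (fun n => (∑ m ∈ Finset.range (n + 1), w m) • (A n - A (n + 1))) := by
    refine Summable.of_norm_bounded (hs.mul_left M) fun n => ?_
    rw [norm_smul, Real.norm_eq_abs]
    have := hw (n + 1)
    gcongr
  refine ⟨h1, ?_⟩
  have h2 : ∀ n, ∑ m ∈ Finset.range n, w m • A m = (∑ m ∈ Finset.range n, w m) • A n +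
      ∑ k ∈ Finset.range n, (∑ m ∈ Finset.range (k + 1), w m) • (A k - A (k + 1)) := by
    intro n
    induction n with
    | zero => simp
    | succ n ih =>
      rw [Finset.sum_range_succ, ih, Finset.sum_range_succ (fun k => (_ : ℝ) • (_ : E)) n,
        Finset.sum_range_succ w n]
      module
  simp only [h2]
  have h3 : Tendsto (fun n => (∑ m ∈ Finset.range n, w m) • A n) atTop (𝓝 0) := by
    refine squeeze_zero_norm (a := fun n => M * ‖A n‖) (fun n => ?_) ?_
    · rw [norm_smul, Real.norm_eq_abs]
      have := hw n
      gcongr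
    · simpa using hA.norm.const_mul M
  simpa using h3.add h1.hasSum.tendsto_sum_nat

lemma exists_bound_of_periodic_nat {f : ℕ → ℝ} {N : ℕ} (hN : 0 < N) (hf : Function.Periodic f N) :
    ∃ M, ∀ n, |f n| ≤ M := by
  refine ⟨∑ k ∈ Finset.range N, |f k|, fun n => ?_⟩
  rw [← hf.map_mod_nat n]
  exact Finset.single_le_sum (f := fun k => |f k|) (fun _ _ => abs_nonneg _)
    (Finset.mem_range.2 (Nat.mod_lt _ hN))

/-- The indicator function of a set of integers, as a real weight. -/
def setWeight (K : Set ℕ) : ℕ → ℝ := K.indicator 1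

lemma setWeight_nonneg (K : Set ℕ) (n : ℕ) : 0 ≤ setWeight K n :=
  Set.indicator_nonneg (fun _ _ => zero_le_one) n

lemma setWeight_le_one (K : Set ℕ) (n : ℕ) : setWeight K n ≤ 1 :=
  Set.indicator_le_self' (fun _ _ => zero_le_one) n

lemma abs_setWeight_le (K : Set ℕ) (n : ℕ) : |setWeight K n| ≤ 1 :=
  abs_le.2 ⟨by linarith [setWeight_nonneg K n], setWeight_le_one K n⟩

/-- Every block of `N` consecutive integers contains exactly `φ(N)` integers coprime to `N`, so the
centred partial sums are periodic. -/
lemma exists_bound_sum_coprime {N : ℕ} (hN : 0 < N) :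
    ∃ M, ∀ n, |∑ m ∈ Finset.range n,
      (setWeight {n | N.Coprime n} (m + 1) - (N.totient : ℝ) / N)| ≤ M := by
  refine exists_bound_of_periodic_nat hN fun n => ?_
  rw [Finset.range_eq_Ico, Finset.range_eq_Ico, ← Finset.sum_Ico_consecutive _ (Nat.zero_le n) (Nat.le_add_right n N),
    add_eq_left, Finset.sum_sub_distrib, Finset.sum_const, Nat.card_Ico, Nat.add_sub_cancel_left,
    nsmul_eq_mul, mul_div_cancel₀ _ (Nat.cast_ne_zero.2 hN.ne'),
    Finset.sum_Ico_add' (fun m => setWeight {n | N.Coprime n} m) n (n + N) 1]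
  have h := Nat.filter_coprime_Ico_eq_totient N (n + 1)
  simp only [setWeight, Set.indicator_apply, Set.mem_ofPred_eq, Pi.one_apply]
  rw [Finset.sum_ite, Finset.sum_const_zero, add_zero, Finset.sum_const, nsmul_eq_mul, mul_one,
    show n + N + 1 = n + 1 + N by ring, h, sub_self]

/-- The weighted rank one operators `(n + 1)⁻¹ E_{σ log (n + 1)}`. -/
def logTerm (T σ : ℝ) (n : ℕ) : L2Interval T →L[ℂ] L2Interval T :=
  ((n : ℝ) + 1)⁻¹ • expOp T (σ * Real.log ((n : ℝ) + 1))

lemma isCompactOperator_logTerm (T σ : ℝ) (n : ℕ) : IsCompactOperator (logTerm T σ n) :=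
  (isCompactOperator_expOp T _).smul ((n : ℝ) + 1)⁻¹

lemma tendsto_logTerm (T σ : ℝ) : Tendsto (logTerm T σ) atTop (𝓝 0) := by
  refine squeeze_zero_norm (a := fun n : ℕ => (1 / ((n : ℝ) + 1)) * expConst T ^ 2)
    (fun n => ?_) ?_
  · rw [logTerm, norm_smul, Real.norm_of_nonneg (by positivity), one_div]
    have := norm_expOp_le T (σ * Real.log ((n : ℝ) + 1))
    gcongr
  · simpa using (tendsto_one_div_add_atTop_nhds_zero_nat (𝕜 := ℝ)).mul_const (expConst T ^ 2)

lemma norm_logTerm_sub_le (T : ℝ) {σ : ℝ} (hσ : |σ| = 1) (n : ℕ) :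
    ‖logTerm T σ n - logTerm T σ (n + 1)‖ ≤ (3 * expConst T ^ 2) * (1 / ((n : ℝ) + 1) ^ 2) := by
  set m : ℝ := (n : ℝ) + 1 with hm
  have hm1 : 1 ≤ m := by linarith [n.cast_nonneg (α := ℝ)]
  have hm0 : 0 < m := by linarith
  have h0 : logTerm T σ n - logTerm T σ (n + 1) =
      (m⁻¹ - (m + 1)⁻¹) • expOp T (σ * Real.log m) +
        (m + 1)⁻¹ • (expOp T (σ * Real.log m) - expOp T (σ * Real.log (m + 1))) := by
    simp only [logTerm, Nat.cast_add, Nat.cast_one, ← hm]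
    module
  have h1 : m⁻¹ - (m + 1)⁻¹ ≤ 1 / m ^ 2 := by
    have : m⁻¹ - (m + 1)⁻¹ = 1 / (m * (m + 1)) := by
      field_simp
      ring
    rw [this]
    gcongr
    nlinarith
  have h1' : 0 ≤ m⁻¹ - (m + 1)⁻¹ := by
    rw [sub_nonneg]
    gcongr
    linarith
  have h2 : |σ * Real.log m - σ * Real.log (m + 1)| ≤ m⁻¹ := by
    rw [← mul_sub, abs_mul, hσ, one_mul, abs_sub_comm, ← Real.log_div (by positivity) hm0.ne',
      abs_of_nonneg (Real.log_nonneg (by rw [le_div_iff₀ hm0]; linarith))]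
    refine (Real.log_le_sub_one_of_pos (by positivity)).trans (le_of_eq ?_)
    field_simp
    ring
  have h3 := norm_expOp_le T (σ * Real.log m)
  have h4 := norm_expOp_sub_le T (σ * Real.log m) (σ * Real.log (m + 1))
  have h5 : (m + 1)⁻¹ ≤ m⁻¹ := by linarith
  rw [h0]
  refine (norm_add_le _ _).trans ?_
  rw [norm_smul, norm_smul, Real.norm_of_nonneg h1', Real.norm_of_nonneg (by positivity)]
  calc _ ≤ (1 / m ^ 2) * expConst T ^ 2 + m⁻¹ * (2 * expConst T ^ 2 * m⁻¹) := by
        gcongr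
        exact h4.trans (by gcongr)
    _ = _ := by
        field_simp
        ring

lemma summable_norm_logTerm_sub (T : ℝ) {σ : ℝ} (hσ : |σ| = 1) :
    Summable fun n => ‖logTerm T σ n - logTerm T σ (n + 1)‖ :=
  Summable.of_nonneg_of_le (fun _ => norm_nonneg _) (norm_logTerm_sub_le T hσ)
    (summable_one_div_succ_sq.mul_left _)

lemma tendsto_logFrameOp (T : ℝ) {σ : ℝ} (hσ : |σ| = 1) (w : ℕ → ℝ) (hw : ∀ n, |w n| ≤ 1)
    (g : L2Interval T) :
    Tendsto (fun N => (∑ n ∈ Finset.range N, w (n + 1) • logTerm T σ n) g) atTop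
      (𝓝 (logFrameOp T hσ w hw g)) := by
  have h := (isBessel_logVec T 0 hσ).hasSum_frameOp w hw g
  have h0 : ((w 0 : ℂ) * inner ℂ (logVec T σ 0 0) g) • logVec T σ 0 0 = 0 := by
    simp [logVec]
  have h1 := ((hasSum_nat_add_iff' 1).2 h).tendsto_sum_nat
  rw [Finset.sum_range_one, h0, sub_zero] at h1
  refine h1.congr fun N => ?_
  rw [sum_apply]
  refine Finset.sum_congr rfl fun n _ => ?_
  rw [mul_smul, inner_logVec_smul, smul_apply, logTerm, smul_apply,
    RCLike.real_smul_eq_coe_smul (K := ℂ) (w (n + 1))]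
  simp

/-- The defining series converges only strongly. Abel summation against weights with bounded partial
sums rewrites it as a norm convergent series of compact operators; the two limits agree at each `g`.
-/
lemma isCompactOperator_coprime_sub (T : ℝ) {σ : ℝ} (hσ : |σ| = 1) {N : ℕ} (hN : 0 < N) :
    IsCompactOperator (logFrameOp T hσ (setWeight {n | N.Coprime n}) (abs_setWeight_le _) -
      ((N.totient : ℝ) / N) • logFrameOp T hσ 1 (by simp) :
      L2Interval T →L[ℂ] L2Interval T) := by
  obtain ⟨M, hM⟩ := exists_bound_sum_coprime hN
  obtain ⟨h1, h2⟩ := tendsto_sum_smul_of_bounded_sums hM (tendsto_logTerm T σ)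
    (summable_norm_logTerm_sub T hσ)
  set S := ∑' n, (∑ m ∈ Finset.range (n + 1),
      (setWeight {n | N.Coprime n} (m + 1) - (N.totient : ℝ) / N)) •
        (logTerm T σ n - logTerm T σ (n + 1)) with hS
  have hSc : IsCompactOperator S := by
    refine isCompactOperator_of_hasSum h1.hasSum fun n => ?_
    have := (isCompactOperator_logTerm T σ n).sub (isCompactOperator_logTerm T σ (n + 1))
    exact this.smul (∑ m ∈ Finset.range (n + 1),
      (setWeight {n | N.Coprime n} (m + 1) - (N.totient : ℝ) / N))
  convert hSc using 2
  ext1 g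
  have h3 := (tendsto_logFrameOp T hσ _ (abs_setWeight_le {n | N.Coprime n}) g).sub
    ((tendsto_logFrameOp T hσ 1 (by simp) g).const_smul ((N.totient : ℝ) / N))
  have h4 := ((ContinuousLinearMap.apply ℂ (L2Interval T) g).continuous.tendsto _).comp h2
  refine tendsto_nhds_unique h3 (h4.congr fun n => ?_)
  simp only [Function.comp_apply, ContinuousLinearMap.apply_apply, sub_smul, Finset.sum_sub_distrib,
    sub_apply, Pi.one_apply, one_smul, Finset.smul_sum, sum_apply, smul_apply]

/-! ### Sieving by finitely many primes outside `Q`. -/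

lemma prod_coprime_iff {F : Finset ℕ} (hF : ∀ p ∈ F, p.Prime) (n : ℕ) :
    (∏ p ∈ F, p).Coprime n ↔ ∀ p ∈ F, ¬ p ∣ n := by
  rw [Nat.coprime_prod_left_iff]
  exact forall₂_congr fun p hp => (hF p hp).coprime_iff_not_dvd

/-- The density `∏_{p ∈ F} (1 - 1/p)` of the integers free of prime factors in `F`. -/
def sieveDensity (F : Finset ℕ) : ℝ := ∏ p ∈ F, (1 - (p : ℝ)⁻¹)

lemma totient_div_eq_sieveDensity {F : Finset ℕ} (hF : ∀ p ∈ F, p.Prime) :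
    ((∏ p ∈ F, p).totient : ℝ) / ((∏ p ∈ F, p : ℕ) : ℝ) = sieveDensity F := by
  have h0 : ((∏ p ∈ F, p : ℕ) : ℝ) ≠ 0 :=
    Nat.cast_ne_zero.2 (Finset.prod_ne_zero_iff.2 fun p hp => (hF p hp).ne_zero)
  have h := Nat.totient_eq_mul_prod_factors (∏ p ∈ F, p)
  rw [Nat.primeFactors_prod hF] at h
  have h' := congrArg (fun q : ℚ => (q : ℝ)) h
  simp only [Rat.cast_mul, Rat.cast_natCast, Rat.cast_prod, Rat.cast_sub, Rat.cast_one,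
    Rat.cast_inv] at h'
  rw [h', mul_div_cancel_left₀ _ h0, sieveDensity]

/-- The integers not divisible by any element of `F`. -/
def sieved (F : Finset ℕ) : Set ℕ := {n | ∀ p ∈ F, ¬ p ∣ n}

/-- The operator `∑_{n ∈ K} n⁻¹ E_{σ log n}`. -/
def halfZetaOp (T : ℝ) {σ : ℝ} (hσ : |σ| = 1) (K : Set ℕ) : L2Interval T →L[ℂ] L2Interval T :=
  logFrameOp T hσ (setWeight K) (abs_setWeight_le K)

lemma isCompactOperator_sieved_sub (T : ℝ) {σ : ℝ} (hσ : |σ| = 1) {F : Finset ℕ}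
    (hF : ∀ p ∈ F, p.Prime) :
    IsCompactOperator (halfZetaOp T hσ (sieved F) -
      sieveDensity F • logFrameOp T hσ 1 (by simp) : L2Interval T →L[ℂ] L2Interval T) := by
  have h1 : {n | (∏ p ∈ F, p).Coprime n} = sieved F := Set.ext fun n => prod_coprime_iff hF n
  have h2 := isCompactOperator_coprime_sub T hσ
    (Finset.prod_pos fun p hp => (hF p hp).pos : 0 < ∏ p ∈ F, p)
  rw [totient_div_eq_sieveDensity hF] at h2
  simp only [h1] at h2
  exact h2

lemma generatedIntegers_subset_sieved {Q : Set ℕ} {F : Finset ℕ}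
    (hF : ↑F ⊆ complementaryPrimes Q) : generatedIntegers Q ⊆ sieved F :=
  fun _ hn p hp hpn => (hF hp).2 (hn.2 p (hF hp).1 hpn)

lemma exists_mem_complementaryPrimes_dvd {Q : Set ℕ} {n : ℕ} (hn : 0 < n)
    (h : n ∉ generatedIntegers Q) : ∃ p ∈ complementaryPrimes Q, p ∣ n := by
  by_contra! hc
  refine h ⟨hn, fun p hp hpn => ?_⟩
  by_contra hpQ
  exact hc p ⟨hp, hpQ⟩ hpn

lemma setWeight_mono {K L : Set ℕ} (h : K ⊆ L) (n : ℕ) : setWeight K n ≤ setWeight L n :=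
  Set.indicator_le_indicator_of_subset h (fun _ => zero_le_one) n

/-- Bessel bound along the multiples of `p`. -/
lemma sum_multiples_le (T : ℝ) {σ : ℝ} (hσ : |σ| = 1) {p : ℕ} (hp : 0 < p) (g : L2Interval T)
    (N : ℕ) :
    ∑ n ∈ (Finset.range N).filter (p ∣ ·), ‖inner ℂ (logVec T σ 0 n) g‖ ^ 2 ≤
      (p : ℝ)⁻¹ * (besselConst T * ‖g‖ ^ 2) := by
  have h1 : ∑ n ∈ (Finset.range N).filter (p ∣ ·), ‖inner ℂ (logVec T σ 0 n) g‖ ^ 2 ≤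
      ∑ m ∈ Finset.range N, ‖inner ℂ (logVec T σ 0 (p * m)) g‖ ^ 2 := by
    rw [← Finset.sum_image (s := Finset.range N) (g := fun m => p * m)
      (f := fun n => ‖inner ℂ (logVec T σ 0 n) g‖ ^ 2)
      (fun a _ b _ hab => Nat.eq_of_mul_eq_mul_left hp hab)]
    refine Finset.sum_le_sum_of_subset_of_nonneg (fun n hn => ?_) fun _ _ _ => by positivity
    obtain ⟨hnN, m, rfl⟩ := Finset.mem_filter.1 hn
    refine Finset.mem_image.2 ⟨m, Finset.mem_range.2 ?_, rfl⟩
    exact (Nat.le_mul_of_pos_left m hp).trans_lt (Finset.mem_range.1 hnN)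
  refine h1.trans ?_
  -- As `log (pm) = log m + log p`, the multiples of `p` give the sequence shifted by `log p`,
  -- scaled by `p^{-1/2}`.
  have h2 : ∀ m : ℕ, ‖inner ℂ (logVec T σ 0 (p * m)) g‖ ^ 2 =
      (p : ℝ)⁻¹ * ‖inner ℂ (logVec T σ (Real.log p) m) g‖ ^ 2 := by
    intro m
    rw [norm_inner_logVec_sq, norm_inner_logVec_sq]
    rcases Nat.eq_zero_or_pos m with rfl | hm
    · simp
    · have hp' : (p : ℝ) ≠ 0 := Nat.cast_ne_zero.2 hp.ne'
      have hm' : (m : ℝ) ≠ 0 := Nat.cast_ne_zero.2 hm.ne'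
      rw [Nat.cast_mul, Real.log_mul hp' hm', add_zero, mul_inv, mul_assoc,
        add_comm (Real.log p)]
  simp only [h2]
  rw [← Finset.mul_sum]
  have := (isBessel_logVec T (Real.log p) hσ).2 g N
  gcongr

/-- A positive integer that survives the sieve but lies outside `K` is divisible by a prime outside
both `Q` and `F`. A union bound over such primes costs `1/p` each. -/
lemma norm_halfZetaOp_sub_sq_le (T : ℝ) {σ : ℝ} (hσ : |σ| = 1) {Q : Set ℕ} {F : Finset ℕ}
    (hF : ↑F ⊆ complementaryPrimes Q) {ε : ℝ}
    (hε : ∀ s : Finset ℕ, ↑s ⊆ complementaryPrimes Q → Disjoint s F →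
      ∑ p ∈ s, (p : ℝ)⁻¹ ≤ ε) (g : L2Interval T) :
    ‖halfZetaOp T hσ (sieved F) g - halfZetaOp T hσ (generatedIntegers Q) g‖ ^ 2 ≤
      besselConst T * (ε * (besselConst T * ‖g‖ ^ 2)) := by
  classical
  have hb := isBessel_logVec T 0 hσ
  refine (hb.norm_frameOp_sub_sq_le (abs_setWeight_le _) (abs_setWeight_le _) g).trans (mul_le_mul_of_nonneg_left ?_ hb.1)
  refine Real.tsum_le_of_sum_range_le (fun n => by positivity) fun N => ?_
  set a : ℕ → ℝ := fun n => ‖inner ℂ (logVec T σ 0 n) g‖ ^ 2 with ha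
  have ha0 : a 0 = 0 := by
    simp [ha, logVec]
  have hapos : ∀ n, 0 ≤ a n := fun n => by positivity
  -- A prime factor of a positive `n < N` is below `N`, so finitely many primes suffice for each
  -- partial sum.
  set s := (Finset.range N).filter fun p => p ∈ complementaryPrimes Q ∧ p ∉ F with hs
  have key : ∀ n ∈ Finset.range N,
      (setWeight (sieved F) n - setWeight (generatedIntegers Q) n) ^ 2 * a n ≤
        ∑ p ∈ s, if p ∣ n then a n else 0 := by
    intro n hn
    have hnn : ∀ p ∈ s, 0 ≤ (if p ∣ n then a n else 0) := fun p _ => by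
      split_ifs
      exacts [hapos n, le_rfl]
    rcases Nat.eq_zero_or_pos n with rfl | hn0
    · rw [ha0]
      simp
    by_cases h1 : n ∈ generatedIntegers Q
    · have h2 := generatedIntegers_subset_sieved hF h1
      simp only [setWeight, Set.indicator_of_mem h1, Set.indicator_of_mem h2]
      simpa using Finset.sum_nonneg hnn
    by_cases h2 : n ∈ sieved F
    · obtain ⟨p, hp, hpn⟩ := exists_mem_complementaryPrimes_dvd hn0 h1
      have hps : p ∈ s := by
        refine Finset.mem_filter.2 ⟨Finset.mem_range.2 ?_, hp, fun hpF => h2 p hpF hpn⟩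
        exact (Nat.le_of_dvd hn0 hpn).trans_lt (Finset.mem_range.1 hn)
      have h3 := Finset.single_le_sum hnn hps
      rw [if_pos hpn] at h3
      simp only [setWeight, Set.indicator_of_notMem h1, Set.indicator_of_mem h2]
      simpa using h3
    · simp only [setWeight, Set.indicator_of_notMem h1, Set.indicator_of_notMem h2]
      simpa using Finset.sum_nonneg hnn
  have hsP : ↑s ⊆ complementaryPrimes Q := fun p hp => (Finset.mem_filter.1 hp).2.1
  have hsF : Disjoint s F :=
    Finset.disjoint_left.2 fun p hp => (Finset.mem_filter.1 hp).2.2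
  have hB : 0 ≤ besselConst T * ‖g‖ ^ 2 := mul_nonneg hb.1 (by positivity)
  calc _ ≤ ∑ n ∈ Finset.range N, ∑ p ∈ s, (if p ∣ n then a n else 0) := Finset.sum_le_sum key
    _ = ∑ p ∈ s, ∑ n ∈ (Finset.range N).filter (p ∣ ·), a n := by
        rw [Finset.sum_comm]
        exact Finset.sum_congr rfl fun p _ => (Finset.sum_filter _ _).symm
    _ ≤ ∑ p ∈ s, (p : ℝ)⁻¹ * (besselConst T * ‖g‖ ^ 2) :=
        Finset.sum_le_sum fun p hp => sum_multiples_le T hσ (hsP hp).1.pos g N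
    _ = (∑ p ∈ s, (p : ℝ)⁻¹) * (besselConst T * ‖g‖ ^ 2) := by rw [Finset.sum_mul]
    _ ≤ _ := mul_le_mul_of_nonneg_right (hε s hsP hsF) hB

/-- Convergent case: a norm limit of the compact operators of `isCompactOperator_sieved_sub`. -/
lemma isCompactOperator_halfZetaOp_sub (T : ℝ) {σ : ℝ} (hσ : |σ| = 1) {Q : Set ℕ} {d : ℝ}
    (h : ∀ ε > 0, ∃ F : Finset ℕ, ↑F ⊆ complementaryPrimes Q ∧ |sieveDensity F - d| ≤ ε ∧
      ∀ s : Finset ℕ, ↑s ⊆ complementaryPrimes Q → Disjoint s F → ∑ p ∈ s, (p : ℝ)⁻¹ ≤ ε) :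
    IsCompactOperator (halfZetaOp T hσ (generatedIntegers Q) -
      d • logFrameOp T hσ 1 (by simp) : L2Interval T →L[ℂ] L2Interval T) := by
  set L := logFrameOp T hσ 1 (by simp) with hL
  have hB := (isBessel_logVec T 0 hσ).1
  have hclosed : IsClosed {f : L2Interval T →L[ℂ] L2Interval T | IsCompactOperator f} :=
    isClosed_setOfPred_isCompactOperator
  change halfZetaOp T hσ (generatedIntegers Q) - d • L ∈
    {f : L2Interval T →L[ℂ] L2Interval T | IsCompactOperator f}
  rw [← hclosed.closure_eq, Metric.mem_closure_iff]
  intro η hη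
  -- The sieving error has norm at most `B √ε`, with `B` the Bessel constant, and the density error
  -- at most `ε ‖L‖`; both become at most `η / 4`.
  set ε := min ((η / (4 * (besselConst T + 1))) ^ 2) (η / (4 * (‖L‖ + 1))) with hεdef
  have hε : 0 < ε := by positivity
  obtain ⟨F, hF, hFd, hFs⟩ := h ε hε
  refine ⟨_, isCompactOperator_sieved_sub T hσ fun p hp => (hF hp).1, ?_⟩
  have h1 : ‖halfZetaOp T hσ (sieved F) - halfZetaOp T hσ (generatedIntegers Q)‖ ≤ η / 4 := by
    refine ContinuousLinearMap.opNorm_le_bound _ (by positivity) fun g => ?_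
    have h2 := norm_halfZetaOp_sub_sq_le T hσ hF hFs g
    refine le_of_sq_le_sq (h2.trans ?_) (by positivity)
    calc besselConst T * (ε * (besselConst T * ‖g‖ ^ 2))
        ≤ besselConst T * ((η / (4 * (besselConst T + 1))) ^ 2 * (besselConst T * ‖g‖ ^ 2)) := by
          gcongr
          exact min_le_left _ _
      _ = (η / 4 * ‖g‖) ^ 2 * (besselConst T / (besselConst T + 1)) ^ 2 := by
          field_simp
      _ ≤ (η / 4 * ‖g‖) ^ 2 * 1 ^ 2 := by
          gcongr
          rw [div_le_one (by positivity)]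
          linarith
      _ = _ := by ring
  have h3 : ‖(sieveDensity F - d) • L‖ ≤ η / 4 := by
    rw [norm_smul, Real.norm_eq_abs]
    calc _ ≤ (η / (4 * (‖L‖ + 1))) * ‖L‖ := by
          gcongr
          exact hFd.trans (min_le_right _ _)
      _ ≤ (η / (4 * (‖L‖ + 1))) * (‖L‖ + 1) := by gcongr; linarith
      _ = _ := by field_simp
  have h4 : halfZetaOp T hσ (generatedIntegers Q) - d • L -
      (halfZetaOp T hσ (sieved F) - sieveDensity F • L) =
      (sieveDensity F - d) • L -
        (halfZetaOp T hσ (sieved F) - halfZetaOp T hσ (generatedIntegers Q)) := by module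
  rw [dist_eq_norm, h4]
  refine (norm_sub_le _ _).trans_lt ?_
  linarith

lemma re_inner_halfZetaOp (T : ℝ) {σ : ℝ} (hσ : |σ| = 1) (K : Set ℕ) (g : L2Interval T) :
    (inner ℂ g (halfZetaOp T hσ K g)).re =
      ∑' n, setWeight K n * ‖inner ℂ (logVec T σ 0 n) g‖ ^ 2 := by
  rw [halfZetaOp, logFrameOp, (isBessel_logVec T 0 hσ).inner_frameOp, Complex.ofReal_re]

/-- Divergent case: the tail of `∑ 1/p` is never small, so the norm estimate is unavailable.
Positivity replaces it: the form is dominated by that of the sieved operator, which is a small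
density times a bounded operator plus a compact one. -/
lemma isCompactOperator_halfZetaOp (T : ℝ) {σ : ℝ} (hσ : |σ| = 1) {Q : Set ℕ}
    (h : ∀ ε > 0, ∃ F : Finset ℕ, ↑F ⊆ complementaryPrimes Q ∧ sieveDensity F ≤ ε) :
    IsCompactOperator (halfZetaOp T hσ (generatedIntegers Q)) := by
  have hb := isBessel_logVec T 0 hσ
  have hB := hb.1
  refine isCompactOperator_of_re_inner_le hB (fun g => ?_) fun ε hε => ?_
  · rw [re_inner_halfZetaOp]
    exact hb.norm_frameOp_sq_le (abs_setWeight_le _) (setWeight_nonneg _) g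
  · obtain ⟨F, hF, hFd⟩ := h (ε / (besselConst T + 1)) (by positivity)
    refine ⟨_, isCompactOperator_sieved_sub T hσ fun p hp => (hF hp).1, fun g => ?_⟩
    have h1 : (inner ℂ g (halfZetaOp T hσ (generatedIntegers Q) g)).re ≤
        (inner ℂ g (halfZetaOp T hσ (sieved F) g)).re := by
      rw [re_inner_halfZetaOp, re_inner_halfZetaOp]
      refine (hb.summable_weight_mul_sq (abs_setWeight_le _) g).tsum_le_tsum (fun n => ?_)
        (hb.summable_weight_mul_sq (abs_setWeight_le _) g)
      have := setWeight_mono (generatedIntegers_subset_sieved hF) n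
      gcongr
    have h2 : (inner ℂ g (logFrameOp T hσ 1 (by simp) g)).re ≤ besselConst T * ‖g‖ ^ 2 := by
      rw [logFrameOp, hb.inner_frameOp, Complex.ofReal_re]
      simpa using hb.tsum_sq_le g
    have h0 : 0 ≤ (inner ℂ g (logFrameOp T hσ 1 (by simp) g)).re := by
      rw [logFrameOp, hb.inner_frameOp, Complex.ofReal_re]
      exact tsum_nonneg fun n => by simp
    have h3 : sieveDensity F * (inner ℂ g (logFrameOp T hσ 1 (by simp) g)).re ≤ ε * ‖g‖ ^ 2 := by
      calc _ ≤ (ε / (besselConst T + 1)) * (besselConst T * ‖g‖ ^ 2) := by gcongr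
        _ ≤ (ε / (besselConst T + 1)) * ((besselConst T + 1) * ‖g‖ ^ 2) := by gcongr; linarith
        _ = _ := by field_simp
    have h4 : (inner ℂ g ((halfZetaOp T hσ (sieved F) -
        sieveDensity F • logFrameOp T hσ 1 (by simp)) g)).re =
        (inner ℂ g (halfZetaOp T hσ (sieved F) g)).re -
          sieveDensity F * (inner ℂ g (logFrameOp T hσ 1 (by simp) g)).re := by
      rw [sub_apply, smul_apply, RCLike.real_smul_eq_coe_smul (K := ℂ), inner_sub_right,
        inner_smul_right, Complex.sub_re]
      congr 1
      exact Complex.re_ofReal_mul _ _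
    rw [h4]
    linarith

/-! ### Euler product, limiting density and convergence of `∑ 1/p`. -/

lemma one_sub_inv_prime_pos {p : ℕ} (hp : p.Prime) : 0 < 1 - (p : ℝ)⁻¹ := by
  rw [sub_pos]
  exact inv_lt_one_of_one_lt₀ (by exact_mod_cast hp.one_lt)

lemma sieveDensity_pos {F : Finset ℕ} (hF : ∀ p ∈ F, p.Prime) : 0 < sieveDensity F :=
  Finset.prod_pos fun p hp => one_sub_inv_prime_pos (hF p hp)

lemma sieveDensity_anti {F G : Finset ℕ} (hG : ∀ p ∈ G, p.Prime) (h : F ⊆ G) :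
    sieveDensity G ≤ sieveDensity F := by
  classical
  rw [sieveDensity, ← Finset.prod_sdiff h]
  refine mul_le_of_le_one_left (sieveDensity_pos fun p hp => hG p (h hp)).le ?_
  refine Finset.prod_le_one (fun p hp => ?_) fun p _ => ?_
  · exact (one_sub_inv_prime_pos (hG p (Finset.mem_sdiff.1 hp).1)).le
  · have : (0 : ℝ) ≤ (p : ℝ)⁻¹ := by positivity
    linarith

/-- Euler product for the sum of reciprocals of the integers composed of the primes in `F`. -/
lemma tsum_factoredNumbers_inv {F : Finset ℕ} (hF : ∀ p ∈ F, p.Prime) :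
    ∑' n : Nat.factoredNumbers F, (((n : ℕ) : ℝ≥0∞))⁻¹ = ENNReal.ofReal (sieveDensity F)⁻¹ := by
  let f : ℕ →* ℝ :=
    { toFun := fun n => (n : ℝ)⁻¹
      map_one' := by simp
      map_mul' := fun a b => by rw [Nat.cast_mul, mul_inv] }
  have h := EulerProduct.summable_and_hasSum_factoredNumbers_prod_filter_prime_geometric (f := f)
    (fun {p} hp => by
      rw [show f p = (p : ℝ)⁻¹ from rfl, Real.norm_of_nonneg (by positivity)]
      linarith [one_sub_inv_prime_pos hp]) F
  have h2 := h.2.tsum_eq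
  rw [Finset.filter_true_of_mem hF, Finset.prod_inv_distrib] at h2
  rw [sieveDensity, show ∏ p ∈ F, (1 - (p : ℝ)⁻¹) = ∏ p ∈ F, (1 - f p) from rfl, ← h2,
    ENNReal.ofReal_tsum_of_nonneg (f := fun n : Nat.factoredNumbers F => f n)
      (fun n => inv_nonneg.2 (Nat.cast_nonneg _)) h.2.summable]
  congr 1
  ext n
  have hn : (0 : ℝ) < ((n : ℕ) : ℝ) := Nat.cast_pos.2 (Nat.pos_of_ne_zero n.2.1)
  rw [show f n = ((n : ℕ) : ℝ)⁻¹ from rfl, ENNReal.ofReal_inv_of_pos hn, ENNReal.ofReal_natCast]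

lemma factoredNumbers_subset_generatedIntegers {P : Set ℕ} {F : Finset ℕ} (hF : ↑F ⊆ P) :
    Nat.factoredNumbers F ⊆ generatedIntegers P := fun _ hn =>
  ⟨Nat.pos_of_ne_zero hn.1, fun p hp hpn => hF (hn.2 p ((Nat.mem_primeFactorsList hn.1).2 ⟨hp, hpn⟩))⟩

lemma inv_sieveDensity_le_zetaKAtOne {Q : Set ℕ} {F : Finset ℕ} (hF : ↑F ⊆ complementaryPrimes Q) :
    ENNReal.ofReal (sieveDensity F)⁻¹ ≤ zetaKAtOne (generatedIntegers (complementaryPrimes Q)) := by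
  rw [← tsum_factoredNumbers_inv fun p hp => (hF hp).1]
  exact ENNReal.tsum_mono_subtype (fun n : ℕ => (n : ℝ≥0∞)⁻¹)
    (factoredNumbers_subset_generatedIntegers hF)

/-- A finite partial sum of `ζ_J(1)` involves only finitely many primes, so it is bounded by a
finite Euler product. With `inv_sieveDensity_le_zetaKAtOne`, this makes `ζ_J(1)` the supremum of
these products. -/
lemma exists_lt_inv_sieveDensity {Q : Set ℕ} {r : ℝ≥0∞}
    (hr : r < zetaKAtOne (generatedIntegers (complementaryPrimes Q))) :
    ∃ F : Finset ℕ, ↑F ⊆ complementaryPrimes Q ∧ r < ENNReal.ofReal (sieveDensity F)⁻¹ := by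
  classical
  rw [zetaKAtOne, ENNReal.tsum_eq_iSup_sum, lt_iSup_iff] at hr
  obtain ⟨s, hs⟩ := hr
  set F : Finset ℕ := s.biUnion fun n => (n : ℕ).primeFactors with hFdef
  have hF : ↑F ⊆ complementaryPrimes Q := by
    intro p hp
    obtain ⟨n, -, hpn⟩ := Finset.mem_biUnion.1 hp
    exact n.2.2 p (Nat.prime_of_mem_primeFactors hpn) (Nat.dvd_of_mem_primeFactors hpn)
  refine ⟨F, hF, hs.trans_le ?_⟩
  rw [← tsum_factoredNumbers_inv fun p hp => (hF hp).1]
  have h1 : ∑ n ∈ s, (((n : ℕ) : ℝ≥0∞))⁻¹ =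
      ∑ n ∈ s.map (Function.Embedding.subtype _), ((n : ℝ≥0∞))⁻¹ := by
    rw [Finset.sum_map]
    rfl
  rw [h1, ← Finset.tsum_subtype]
  refine ENNReal.tsum_mono_subtype (fun n : ℕ => (n : ℝ≥0∞)⁻¹) fun n hn => ?_
  obtain ⟨m, hm, rfl⟩ := Finset.mem_map.1 hn
  refine ⟨m.2.1.ne', fun p hp => ?_⟩
  rw [hFdef]
  exact Finset.mem_biUnion.2 ⟨m, hm, List.mem_toFinset.2 hp⟩

/-- The density `1 / ζ_J(1)`. -/
def limitDensity (Q : Set ℕ) : ℝ :=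
  ((zetaKAtOne (generatedIntegers (complementaryPrimes Q)))⁻¹).toReal

lemma one_le_zetaKAtOne (Q : Set ℕ) :
    1 ≤ zetaKAtOne (generatedIntegers (complementaryPrimes Q)) := by
  have := inv_sieveDensity_le_zetaKAtOne (Q := Q) (F := ∅) (by simp)
  simpa [sieveDensity] using this

lemma ofReal_limitDensity (Q : Set ℕ) :
    ENNReal.ofReal (limitDensity Q) =
      (zetaKAtOne (generatedIntegers (complementaryPrimes Q)))⁻¹ := by
  refine ENNReal.ofReal_toReal (ENNReal.inv_ne_top.2 ?_)
  exact (zero_lt_one.trans_le (one_le_zetaKAtOne Q)).ne'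

lemma limitDensity_nonneg (Q : Set ℕ) : 0 ≤ limitDensity Q := ENNReal.toReal_nonneg

lemma limitDensity_le {Q : Set ℕ} {F : Finset ℕ} (hF : ↑F ⊆ complementaryPrimes Q) :
    limitDensity Q ≤ sieveDensity F := by
  have hpos := sieveDensity_pos fun p hp => (hF hp).1
  have h := inv_sieveDensity_le_zetaKAtOne hF
  rw [ENNReal.ofReal_inv_of_pos hpos, ENNReal.inv_le_iff_inv_le, ← ofReal_limitDensity] at h
  exact (ENNReal.ofReal_le_ofReal_iff hpos.le).1 h

/-- Stated for all `G ⊇ F` so that further primes can be adjoined to make the tail of `∑ 1/p` small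
as well. -/
lemma exists_sieveDensity_le (Q : Set ℕ) {ε : ℝ} (hε : 0 < ε) :
    ∃ F : Finset ℕ, ↑F ⊆ complementaryPrimes Q ∧
      ∀ G : Finset ℕ, ↑G ⊆ complementaryPrimes Q → F ⊆ G → |sieveDensity G - limitDensity Q| ≤ ε := by
  have h1 : ENNReal.ofReal (limitDensity Q) < ENNReal.ofReal (limitDensity Q + ε) :=
    (ENNReal.ofReal_lt_ofReal_iff (by linarith [limitDensity_nonneg Q])).2 (by linarith)
  rw [ofReal_limitDensity, ENNReal.inv_lt_iff_inv_lt] at h1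
  obtain ⟨F, hF, hlt⟩ := exists_lt_inv_sieveDensity h1
  refine ⟨F, hF, fun G hG hFG => ?_⟩
  have hpos := sieveDensity_pos fun p hp => (hF hp).1
  rw [ENNReal.ofReal_inv_of_pos hpos, ENNReal.inv_lt_inv,
    ENNReal.ofReal_lt_ofReal_iff (by linarith [limitDensity_nonneg Q])] at hlt
  have h2 := sieveDensity_anti (fun p hp => (hG hp).1) hFG
  have h3 := limitDensity_le hG
  rw [abs_le]
  constructor <;> linarith

/-- In one direction `(1 - 1/p)⁻¹ ≤ 1 + 2/p ≤ e^{2/p}` bounds every finite Euler product; in the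
other, the primes outside `Q` themselves belong to `J`. -/
lemma summable_complementaryPrimes_iff (Q : Set ℕ) :
    Summable (fun p : complementaryPrimes Q => 1 / ((p : ℕ) : ℝ)) ↔ 0 < limitDensity Q := by
  classical
  rw [← ENNReal.ofReal_pos, ofReal_limitDensity, ENNReal.inv_pos]
  constructor
  · intro hs htop
    set S := ∑' p : complementaryPrimes Q, 1 / ((p : ℕ) : ℝ) with hS
    have h1 : ENNReal.ofReal (Real.exp (2 * S)) <
        zetaKAtOne (generatedIntegers (complementaryPrimes Q)) := by
      rw [htop]
      exact ENNReal.ofReal_lt_top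
    obtain ⟨F, hF, hlt⟩ := exists_lt_inv_sieveDensity h1
    refine absurd (ENNReal.ofReal_le_ofReal ?_) (not_le.2 hlt)
    rw [sieveDensity, ← Finset.prod_inv_distrib]
    have h2 : ∑ p ∈ F, 1 / (p : ℝ) ≤ S := by
      have := hs.sum_le_tsum (F.subtype (· ∈ complementaryPrimes Q)) fun p _ => by positivity
      rw [Finset.sum_subtype_of_mem (fun n : ℕ => 1 / (n : ℝ)) fun x hx => hF hx] at this
      exact this
    calc ∏ p ∈ F, (1 - (p : ℝ)⁻¹)⁻¹ ≤ ∏ p ∈ F, Real.exp (2 * (1 / (p : ℝ))) := by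
          refine Finset.prod_le_prod (fun p hp => ?_) fun p hp => ?_
          · exact (inv_pos.2 (one_sub_inv_prime_pos (hF hp).1)).le
          · have hp2 : (2 : ℝ) ≤ p := by exact_mod_cast (hF hp).1.two_le
            refine le_trans ?_ (Real.add_one_le_exp _)
            have h3 : (1 - (p : ℝ)⁻¹)⁻¹ = p / (p - 1) := by
              have : (p : ℝ) - 1 ≠ 0 := by linarith
              field_simp
            rw [h3, div_le_iff₀ (by linarith)]
            have h4 : (2 * (1 / (p : ℝ)) + 1) * (p - 1) = p + (1 - 2 / p) := by
              field_simp
              ring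
            rw [h4]
            have : 2 / (p : ℝ) ≤ 1 := by rw [div_le_one (by linarith)]; exact hp2
            linarith
      _ = Real.exp (2 * ∑ p ∈ F, 1 / (p : ℝ)) := by rw [← Real.exp_sum, Finset.mul_sum]
      _ ≤ _ := Real.exp_le_exp.2 (by linarith)
  · intro htop
    refine summable_of_sum_le (c := (zetaKAtOne (generatedIntegers (complementaryPrimes Q))).toReal)
      (fun p => by positivity) fun s => ?_
    rw [← ENNReal.ofReal_le_iff_le_toReal htop, ENNReal.ofReal_sum_of_nonneg fun p _ => by positivity]
    have hsub : complementaryPrimes Q ⊆ generatedIntegers (complementaryPrimes Q) := fun p hp =>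
      ⟨hp.1.pos, fun q hq hqp => ((Nat.prime_dvd_prime_iff_eq hq hp.1).1 hqp) ▸ hp⟩
    calc ∑ p ∈ s, ENNReal.ofReal (1 / ((p : ℕ) : ℝ)) = ∑ p ∈ s, (((p : ℕ) : ℝ≥0∞))⁻¹ := by
          refine Finset.sum_congr rfl fun p _ => ?_
          rw [one_div, ENNReal.ofReal_inv_of_pos (Nat.cast_pos.2 p.2.1.pos), ENNReal.ofReal_natCast]
      _ ≤ ∑' p : complementaryPrimes Q, (((p : ℕ) : ℝ≥0∞))⁻¹ := ENNReal.sum_le_tsum s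
      _ ≤ _ := ENNReal.tsum_mono_subtype (fun n : ℕ => (n : ℝ≥0∞)⁻¹) hsub

lemma exists_sieve_approx {Q : Set ℕ}
    (hs : Summable (fun p : complementaryPrimes Q => 1 / ((p : ℕ) : ℝ))) {ε : ℝ} (hε : 0 < ε) :
    ∃ F : Finset ℕ, ↑F ⊆ complementaryPrimes Q ∧ |sieveDensity F - limitDensity Q| ≤ ε ∧
      ∀ s : Finset ℕ, ↑s ⊆ complementaryPrimes Q → Disjoint s F → ∑ p ∈ s, (p : ℝ)⁻¹ ≤ ε := by
  classical
  obtain ⟨F₁, hF₁, h1⟩ := exists_sieveDensity_le Q hε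
  obtain ⟨t, ht⟩ := summable_iff_vanishing_norm.1 hs ε hε
  set F₂ := t.map (Function.Embedding.subtype _) with hF₂
  have hF₂P : ↑F₂ ⊆ complementaryPrimes Q := by
    intro p hp
    obtain ⟨q, -, rfl⟩ := Finset.mem_map.1 hp
    exact q.2
  refine ⟨F₁ ∪ F₂, by rw [Finset.coe_union]; exact Set.union_subset hF₁ hF₂P, ?_, fun s hs hd => ?_⟩
  · exact h1 _ (by rw [Finset.coe_union]; exact Set.union_subset hF₁ hF₂P) Finset.subset_union_left
  · have h2 := ht (s.subtype (· ∈ complementaryPrimes Q)) (by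
      rw [Finset.disjoint_left]
      intro p hp hpt
      refine Finset.disjoint_left.1 hd (Finset.mem_subtype.1 hp) (Finset.mem_union_right _ ?_)
      exact Finset.mem_map.2 ⟨p, hpt, rfl⟩)
    rw [Finset.sum_subtype_of_mem (fun n : ℕ => 1 / (n : ℝ)) fun x hx => hs hx] at h2
    simp only [one_div] at h2
    exact (le_abs_self _).trans h2.le

lemma exists_sieveDensity_le_of_not_summable {Q : Set ℕ}
    (hs : ¬ Summable (fun p : complementaryPrimes Q => 1 / ((p : ℕ) : ℝ))) {ε : ℝ} (hε : 0 < ε) :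
    ∃ F : Finset ℕ, ↑F ⊆ complementaryPrimes Q ∧ sieveDensity F ≤ ε := by
  rw [summable_complementaryPrimes_iff, not_lt] at hs
  obtain ⟨F, hF, h⟩ := exists_sieveDensity_le Q hε
  refine ⟨F, hF, ?_⟩
  have := (abs_le.1 (h F hF subset_rfl)).2
  linarith

/-! ### Uniqueness from many zeros of a function of exponential type. -/

/-- Repeated use of Rolle's theorem: a smooth function with `N + 1` zeros has a zero of its `N`-th
derivative. -/
lemma exists_iteratedDeriv_eq_zero {N : ℕ} {f : ℝ → ℝ} (hf : ContDiff ℝ (⊤ : ℕ∞) f)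
    {x : Fin (N + 1) → ℝ} (hx : StrictMono x) (h0 : ∀ i, f (x i) = 0) :
    ∃ ξ, iteratedDeriv N f ξ = 0 := by
  induction N generalizing f with
  | zero => exact ⟨x 0, by rw [iteratedDeriv_zero]; exact h0 0⟩
  | succ N ih =>
    have h1 : ∀ i : Fin (N + 1), ∃ c ∈ Set.Ioo (x i.castSucc) (x i.succ), deriv f c = 0 := fun i =>
      exists_deriv_eq_zero (hx Fin.castSucc_lt_succ) hf.continuous.continuousOn (by rw [h0, h0])
    choose c hc hc0 using h1
    have hcm : StrictMono c := fun i j hij =>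
      (hc i).2.trans_le ((hx.monotone (Fin.succ_le_castSucc_iff.2 hij)).trans (hc j).1.le)
    rw [iteratedDeriv_succ']
    exact ih ((contDiff_infty_iff_deriv.1 hf).2) hcm hc0

lemma iteratedDeriv_polynomial_eval (p : Polynomial ℝ) (N : ℕ) :
    iteratedDeriv N (fun x => p.eval x) =
      fun x => (Polynomial.derivative^[N] p).eval x := by
  induction N with
  | zero => simp
  | succ N ih =>
    rw [iteratedDeriv_succ, ih]
    ext x
    rw [Polynomial.deriv, Function.iterate_succ_apply']

lemma iteratedDeriv_monic {p : Polynomial ℝ} (hp : p.Monic) (x : ℝ) :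
    iteratedDeriv p.natDegree (fun x => p.eval x) x = (p.natDegree).factorial := by
  rw [iteratedDeriv_polynomial_eval]
  have h1 := Polynomial.natDegree_iterate_derivative p p.natDegree
  rw [Nat.sub_self] at h1
  rw [Polynomial.eq_C_of_natDegree_le_zero h1]
  simp [Polynomial.coeff_iterate_derivative, Nat.descFactorial_self, hp]

/-- The error bound of polynomial interpolation, for a function vanishing at the nodes. -/
lemma abs_le_of_zeros {f : ℝ → ℝ} (hf : ContDiff ℝ (⊤ : ℕ∞) f) (s : Finset ℝ)
    (h0 : ∀ y ∈ s, f y = 0) {M : ℝ} (hM : ∀ ξ, |iteratedDeriv s.card f ξ| ≤ M) (x : ℝ) :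
    |f x| ≤ M / s.card.factorial * ∏ y ∈ s, |x - y| := by
  classical
  by_cases hx : x ∈ s
  · rw [h0 x hx, abs_zero]
    have := (abs_nonneg _).trans (hM 0)
    positivity
  set p : Polynomial ℝ := ∏ y ∈ s, (Polynomial.X - Polynomial.C y) with hp
  have hpm : p.Monic := Polynomial.monic_prod_of_monic _ _ fun y _ => Polynomial.monic_X_sub_C y
  have hpd : p.natDegree = s.card := by
    rw [hp, Polynomial.natDegree_prod_of_monic _ _ fun y _ => Polynomial.monic_X_sub_C y]
    simp
  have hpe : ∀ z, p.eval z = ∏ y ∈ s, (z - y) := fun z => by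
    rw [hp, Polynomial.eval_prod]
    simp
  have hpx : p.eval x ≠ 0 := by
    rw [hpe, Finset.prod_ne_zero_iff]
    intro y hy hxy
    exact hx (by rwa [sub_eq_zero.1 hxy])
  -- This choice makes `f - c p` vanish at `x` as well as at the nodes, so Rolle gives `f⁽ᴺ⁾(ξ) = c
  -- N!` with `N` the number of nodes.
  set c := f x / p.eval x with hc
  have hpc : ContDiff ℝ (⊤ : ℕ∞) fun z => p.eval z := by
    simpa using p.contDiff_aeval (𝕜 := ℝ) (⊤ : ℕ∞)
  have hG : ContDiff ℝ (⊤ : ℕ∞) fun z => f z - c * p.eval z := hf.sub (contDiff_const.mul hpc)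
  have hcard : (insert x s).card = s.card + 1 := Finset.card_insert_of_notMem hx
  obtain ⟨ξ, hξ⟩ := exists_iteratedDeriv_eq_zero hG ((insert x s).orderEmbOfFin hcard).strictMono
    (fun i => by
      have hi := Finset.orderEmbOfFin_mem (insert x s) hcard i
      rcases Finset.mem_insert.1 hi with h | h
      · rw [h, hc, div_mul_cancel₀ _ hpx, sub_self]
      · rw [h0 _ h, hpe, Finset.prod_eq_zero h (sub_self _), mul_zero, sub_self])
  have h1 : iteratedDeriv s.card (fun z => f z - c * p.eval z) ξ =
      iteratedDeriv s.card f ξ - c * s.card.factorial := by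
    have := iteratedDeriv_sub (n := s.card) (x := ξ) (f := f) (g := fun z => c * p.eval z)
      (hf.contDiffAt.of_le (by exact_mod_cast le_top))
      ((contDiff_const.mul hpc).contDiffAt.of_le (by exact_mod_cast le_top))
    rw [show (fun z => f z - c * p.eval z) = f - fun z => c * p.eval z from rfl, this,
      iteratedDeriv_const_mul_field]
    congr 2
    have h2 := iteratedDeriv_monic hpm ξ
    rwa [hpd] at h2
  rw [h1, sub_eq_zero] at hξ
  have h3 := hM ξ
  have hfac : (0 : ℝ) < s.card.factorial := by positivity
  rw [hξ, abs_mul, abs_of_pos hfac, ← le_div_iff₀ hfac] at h3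
  have h4 : f x = c * p.eval x := by rw [hc, div_mul_cancel₀ _ hpx]
  rw [h4, abs_mul, hpe, Finset.abs_prod]
  gcongr

/-- A function of exponential type on the line with too many zeros vanishes. -/
lemma eq_zero_of_many_zeros {f : ℝ → ℝ} (hf : ContDiff ℝ (⊤ : ℕ∞) f) {A R D : ℝ} (hA : 0 ≤ A)
    (hR : 0 ≤ R) (hD : 0 ≤ D) (hbd : ∀ N ξ, |iteratedDeriv N f ξ| ≤ A * R ^ N)
    (hz : ∀ m : ℕ, ∃ s : Finset ℝ, s.card = m ^ 2 ∧ ∀ y ∈ s, f y = 0 ∧ |y| ≤ D * m) (x : ℝ) :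
    f x = 0 := by
  set C := R * (|x| + D) with hC
  have hC0 : 0 ≤ C := by positivity
  -- Interpolation at `N = m²` zeros bounds `|f x|` by `A (C (m + 1))^N / N!`. Applying `y^N / N! ≤
  -- e^y` with `y = e C (m + 1)` gains the factor `e^{-N}`, which beats the linear exponent.
  have key : ∀ m : ℕ, |f x| ≤ A * Real.exp (Real.exp 1 * (C * (m + 1)) - (m : ℝ) ^ 2) := by
    intro m
    obtain ⟨s, hs, hsz⟩ := hz m
    have h1 := abs_le_of_zeros hf s (fun y hy => (hsz y hy).1) (hbd s.card) x
    have h2 : ∏ y ∈ s, |x - y| ≤ ((|x| + D) * (m + 1)) ^ s.card := by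
      rw [← Finset.prod_const]
      refine Finset.prod_le_prod (fun _ _ => abs_nonneg _) fun y hy => ?_
      have h3 := (hsz y hy).2
      have h4 := abs_sub x y
      nlinarith [abs_nonneg x, m.cast_nonneg (α := ℝ)]
    have h5 := Real.pow_div_factorial_le_exp (x := Real.exp 1 * (C * (m + 1))) (by positivity) s.card
    calc |f x| ≤ A * R ^ s.card / s.card.factorial * ((|x| + D) * (m + 1)) ^ s.card :=
          h1.trans (by gcongr)
      _ = A * (((Real.exp 1 * (C * (m + 1))) ^ s.card / s.card.factorial) / Real.exp 1 ^ s.card) := by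
          have := Real.exp_pos 1
          simp only [hC, mul_pow]
          field_simp
      _ ≤ A * (Real.exp (Real.exp 1 * (C * (m + 1))) / Real.exp 1 ^ s.card) := by gcongr
      _ = _ := by
          rw [Real.exp_sub, ← Real.exp_nat_mul, hs]
          push_cast
          rw [mul_one]
  have hlim : Tendsto (fun m : ℕ => A * Real.exp (Real.exp 1 * (C * (m + 1)) - (m : ℝ) ^ 2)) atTop
      (𝓝 (A * 0)) := by
    refine (Real.tendsto_exp_atBot.comp ?_).const_mul A
    set K := Real.exp 1 * C with hK
    -- The majorant comes from `(K + 1) m - m² ≤ (K + 1)²`.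
    refine tendsto_atBot_mono (f := fun m : ℕ => K + (K + 1) ^ 2 - (m : ℝ)) (fun m => ?_) ?_
    · rw [← mul_assoc, ← hK]
      nlinarith [sq_nonneg ((m : ℝ) - (K + 1))]
    · exact tendsto_atBot_add_const_left _ _ (tendsto_neg_atTop_atBot.comp tendsto_natCast_atTop_atTop)
  rw [mul_zero] at hlim
  exact abs_nonpos_iff.1 (ge_of_tendsto' hlim key)

lemma iteratedDeriv_clm_comp (L : ℂ →L[ℝ] ℝ) {f : ℝ → ℂ} (hf : ContDiff ℝ (⊤ : ℕ∞) f) (N : ℕ) :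
    iteratedDeriv N (fun x => L (f x)) = fun x => L (iteratedDeriv N f x) := by
  induction N with
  | zero => simp
  | succ N ih =>
    rw [iteratedDeriv_succ, ih, iteratedDeriv_succ]
    ext x
    have h1 : DifferentiableAt ℝ (iteratedDeriv N f) x :=
      (hf.differentiable_iteratedDeriv N (by exact_mod_cast WithTop.coe_lt_top N)) x
    exact (L.hasFDerivAt.comp_hasDerivAt x h1.hasDerivAt).deriv

/-- Support in `(-T, T)` bounds the `N`-th derivative of the transform by `(2πT)^N` times the `L¹`
norm of `g`. -/
lemma fourier_zeroExt_eq_zero {T : ℝ} (hT : 0 < T) (g : L2Interval T) {D : ℝ} (hD : 0 ≤ D)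
    (hz : ∀ m : ℕ, ∃ s : Finset ℝ, s.card = m ^ 2 ∧ ∀ y ∈ s,
      FourierTransform.fourier (zeroExt g) y = 0 ∧ |y| ≤ D * m) (x : ℝ) :
    FourierTransform.fourier (zeroExt g) x = 0 := by
  have hsupp : ∀ t, t ∉ Set.Ioo (-T) T → zeroExt g t = 0 := fun t ht => Set.indicator_of_notMem ht _
  have hle : ∀ (n : ℕ) t, ‖t‖ ^ n * ‖zeroExt g t‖ ≤ T ^ n * ‖zeroExt g t‖ := by
    intro n t
    by_cases ht : t ∈ Set.Ioo (-T) T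
    · have : ‖t‖ ≤ T := abs_le.2 ⟨ht.1.le, ht.2.le⟩
      gcongr
    · rw [hsupp t ht, norm_zero, mul_zero, mul_zero]
  have hI := integrable_zeroExt g
  have hint : ∀ n : ℕ, Integrable (fun t => ‖t‖ ^ n * ‖zeroExt g t‖) volume := by
    intro n
    refine (hI.norm.const_mul (T ^ n)).mono ?_ (Eventually.of_forall fun t => ?_)
    · exact (by fun_prop : Continuous fun t : ℝ => ‖t‖ ^ n).aestronglyMeasurable.mul
        hI.aestronglyMeasurable.norm
    · refine (le_of_eq (Real.norm_of_nonneg (by positivity))).trans ((hle n t).trans (le_abs_self _))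
  have hsm : ContDiff ℝ (⊤ : ℕ∞) (FourierTransform.fourier (zeroExt g) : ℝ → ℂ) :=
    Real.contDiff_fourier fun n _ => hint n
  have hbd : ∀ N ξ, ‖iteratedDeriv N (FourierTransform.fourier (zeroExt g) : ℝ → ℂ) ξ‖ ≤
      (∫ t, ‖zeroExt g t‖) * (2 * Real.pi * T) ^ N := by
    intro N ξ
    rw [Real.iteratedDeriv_fourier (N := ⊤) (fun n _ => ?_) le_top]
    · refine (VectorFourier.norm_fourierIntegral_le_integral_norm _ _ _ _ _).trans ?_
      rw [mul_comm (∫ t, ‖zeroExt g t‖), ← integral_const_mul]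
      refine integral_mono_of_nonneg (Eventually.of_forall fun t => norm_nonneg _)
        (hI.norm.const_mul _) (Eventually.of_forall fun t => ?_)
      have h1 : ‖(-2 * (Real.pi : ℂ) * Complex.I * (t : ℂ)) ^ N • zeroExt g t‖ =
          (2 * Real.pi) ^ N * (‖t‖ ^ N * ‖zeroExt g t‖) := by
        rw [norm_smul, norm_pow]
        simp only [norm_mul, norm_neg, Complex.norm_ofNat, Complex.norm_real, Complex.norm_I, mul_one]
        rw [Real.norm_of_nonneg Real.pi_pos.le, mul_pow]
        ring
      change ‖(-2 * (Real.pi : ℂ) * Complex.I * (t : ℂ)) ^ N • zeroExt g t‖ ≤ _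
      rw [h1]
      calc _ ≤ (2 * Real.pi) ^ N * (T ^ N * ‖zeroExt g t‖) := by
            have := hle N t
            gcongr
        _ = _ := by ring
    · refine (integrable_norm_iff ?_).1 ?_
      · exact (by fun_prop : Continuous fun t : ℝ => t ^ n).aestronglyMeasurable.smul
          hI.aestronglyMeasurable
      · simpa only [norm_smul, norm_pow] using hint n
  have hA : 0 ≤ ∫ t, ‖zeroExt g t‖ := integral_nonneg fun _ => norm_nonneg _
  -- Rolle's theorem needs real values, so real and imaginary parts are treated separately.
  have hpart : ∀ L : ℂ →L[ℝ] ℝ, (∀ z, |L z| ≤ ‖z‖) →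
      L (FourierTransform.fourier (zeroExt g) x) = 0 := by
    intro L hL
    refine eq_zero_of_many_zeros (f := fun x => L (FourierTransform.fourier (zeroExt g) x))
      (L.contDiff.comp hsm) hA (by positivity : 0 ≤ 2 * Real.pi * T) hD (fun N ξ => ?_)
      (fun m => ?_) x
    · rw [iteratedDeriv_clm_comp L hsm]
      exact (hL _).trans (hbd N ξ)
    · obtain ⟨s, hs, hsz⟩ := hz m
      exact ⟨s, hs, fun y hy => ⟨by rw [(hsz y hy).1, map_zero], (hsz y hy).2⟩⟩
  exact Complex.ext (hpart Complex.reCLM Complex.abs_re_le_norm)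
    (hpart Complex.imCLM Complex.abs_im_le_norm)

/-- The sum of `1/p` over all primes diverges, so `Q` must be infinite. -/
lemma exists_two_primes {Q : Set ℕ} (hQ : ∀ p ∈ Q, p.Prime)
    (hs : Summable (fun p : complementaryPrimes Q => 1 / ((p : ℕ) : ℝ))) :
    ∃ p ∈ Q, ∃ q ∈ Q, p ≠ q := by
  have hinf : Q.Infinite := by
    intro hfin
    refine not_summable_one_div_on_primes ?_
    have h1 : Summable ((complementaryPrimes Q).indicator fun n : ℕ => 1 / (n : ℝ)) :=
      summable_subtype_iff_indicator.1 hs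
    have h2 : Summable (Q.indicator fun n : ℕ => 1 / (n : ℝ)) :=
      summable_of_hasFiniteSupport (hfin.subset Set.support_indicator_subset)
    have h3 : {p : ℕ | p.Prime} = complementaryPrimes Q ∪ Q := by
      ext p
      constructor
      · intro hp
        by_cases hpQ : p ∈ Q
        exacts [Or.inr hpQ, Or.inl ⟨hp, hpQ⟩]
      · rintro (hp | hp)
        exacts [hp.1, hQ p hp]
    rw [h3, Set.indicator_union_of_disjoint]
    · exact h1.add h2
    · exact Set.disjoint_left.2 fun p hp => hp.2
  obtain ⟨p, hp⟩ := hinf.nonempty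
  obtain ⟨q, hq, hqp⟩ := hinf.exists_notMem_finset {p}
  exact ⟨p, hp, q, hq, fun h => hqp (by simp [h])⟩

lemma prime_pow_mul_prime_pow_injective {p q : ℕ} (hp : p.Prime) (hq : q.Prime) (hpq : p ≠ q) :
    Function.Injective fun ab : ℕ × ℕ => p ^ ab.1 * q ^ ab.2 := by
  have key : ∀ a b : ℕ, (p ^ a * q ^ b).factorization p = a ∧
      (p ^ a * q ^ b).factorization q = b := by
    intro a b
    rw [Nat.factorization_mul (pow_ne_zero _ hp.ne_zero) (pow_ne_zero _ hq.ne_zero),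
      hp.factorization_pow, hq.factorization_pow]
    simp [hpq, hpq.symm]
  rintro ⟨a, b⟩ ⟨c, d⟩ h
  have h1 := key a b
  have h2 := key c d
  simp only at h
  rw [h] at h1
  exact Prod.ext (h1.1.symm.trans h2.1) (h1.2.symm.trans h2.2)

/-- The `m²` numbers `p^a q^b` with `a, b < m` are distinct and their logarithms are `O(m)`. Powers
of a single prime would give only an arithmetic progression, too sparse for large `T`. -/
lemma eq_zero_of_inner_expL2_log_eq_zero {T : ℝ} (hT : 0 < T) {Q : Set ℕ} (hQ : ∀ p ∈ Q, p.Prime)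
    (hs : Summable (fun p : complementaryPrimes Q => 1 / ((p : ℕ) : ℝ))) (g : L2Interval T)
    (h : ∀ n ∈ generatedIntegers Q, inner ℂ (expL2 T (Real.log n)) g = 0) : g = 0 := by
  classical
  obtain ⟨p, hp, q, hq, hpq⟩ := exists_two_primes hQ hs
  have hpp := hQ p hp
  have hqp := hQ q hq
  have hlp : 0 ≤ Real.log p := Real.log_natCast_nonneg p
  have hlq : 0 ≤ Real.log q := Real.log_natCast_nonneg q
  have hpi := Real.pi_pos
  set D := (Real.log p + Real.log q) / (2 * Real.pi) with hD
  have hzero : ∀ x, FourierTransform.fourier (zeroExt g) x = 0 := by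
    refine fourier_zeroExt_eq_zero hT g (by positivity : 0 ≤ D) fun m => ?_
    refine ⟨(Finset.range m ×ˢ Finset.range m).image fun ab : ℕ × ℕ =>
      Real.log ((p ^ ab.1 * q ^ ab.2 : ℕ) : ℝ) / (2 * Real.pi), ?_, ?_⟩
    · rw [Finset.card_image_of_injective, Finset.card_product, Finset.card_range, pow_two]
      intro x y hxy
      apply prime_pow_mul_prime_pow_injective hpp hqp hpq
      have hpos : ∀ z : ℕ × ℕ, (0 : ℝ) < ((p ^ z.1 * q ^ z.2 : ℕ) : ℝ) := fun z =>
        Nat.cast_pos.2 (Nat.mul_pos (pow_pos hpp.pos _) (pow_pos hqp.pos _))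
      have h1 := (div_left_inj' (by positivity : (2 * Real.pi) ≠ 0)).1 hxy
      exact Nat.cast_injective (Real.log_injOn_pos (hpos x) (hpos y) h1)
    · intro y hy
      obtain ⟨⟨a, b⟩, hab, rfl⟩ := Finset.mem_image.1 hy
      obtain ⟨ha, hb⟩ := Finset.mem_product.1 hab
      constructor
      · rw [fourier_zeroExt, mul_div_cancel₀ _ (by positivity)]
        refine h _ ⟨Nat.mul_pos (pow_pos hpp.pos _) (pow_pos hqp.pos _), fun r hr hrd => ?_⟩
        rcases hr.dvd_mul.1 hrd with h1 | h1
        · rwa [(Nat.prime_dvd_prime_iff_eq hr hpp).1 (hr.dvd_of_dvd_pow h1)]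
        · rwa [(Nat.prime_dvd_prime_iff_eq hr hqp).1 (hr.dvd_of_dvd_pow h1)]
      · have ha' : (a : ℝ) ≤ m := Nat.cast_le.2 (Finset.mem_range.1 ha).le
        have hb' : (b : ℝ) ≤ m := Nat.cast_le.2 (Finset.mem_range.1 hb).le
        have hp0 : (p : ℝ) ≠ 0 := Nat.cast_ne_zero.2 hpp.ne_zero
        have hq0 : (q : ℝ) ≠ 0 := Nat.cast_ne_zero.2 hqp.ne_zero
        push_cast
        rw [Real.log_mul (pow_ne_zero _ hp0) (pow_ne_zero _ hq0), Real.log_pow, Real.log_pow,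
          abs_of_nonneg (by positivity), hD, div_mul_eq_mul_div]
        gcongr
        nlinarith
  have hP := (plancherel_expL2 g).2
  have h2 : ∀ x, inner ℂ (expL2 T x) g = 0 := by
    intro x
    have := hzero (x / (2 * Real.pi))
    rwa [fourier_zeroExt, mul_div_cancel₀ _ (by positivity)] at this
  simp only [h2] at hP
  simpa [hpi.ne'] using hP.symm

/-! ### The regularised convolution and its limit. -/

/-- The smoothed weights `n ↦ 1_K(n) n^{-|δ|}`. -/
def smoothWeight (K : Set ℕ) (δ : ℝ) (n : ℕ) : ℝ := setWeight K n * (n : ℝ) ^ (-|δ|)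

lemma smoothWeight_nonneg (K : Set ℕ) (δ : ℝ) (n : ℕ) : 0 ≤ smoothWeight K δ n :=
  mul_nonneg (setWeight_nonneg K n) (by positivity)

lemma smoothWeight_le_rpow (K : Set ℕ) (δ : ℝ) (n : ℕ) : smoothWeight K δ n ≤ (n : ℝ) ^ (-|δ|) :=
  mul_le_of_le_one_left (by positivity) (setWeight_le_one K n)

/-- The absolute value in the exponent makes the bound hold for every real `δ`, as `tendsto_frameOp`
requires of the whole family. -/
lemma abs_smoothWeight_le (K : Set ℕ) (δ : ℝ) (n : ℕ) : |smoothWeight K δ n| ≤ 1 := by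
  rw [abs_of_nonneg (smoothWeight_nonneg K δ n)]
  refine (smoothWeight_le_rpow K δ n).trans ?_
  rcases Nat.eq_zero_or_pos n with rfl | hn
  · rw [Nat.cast_zero]
    exact Real.zero_rpow_le_one _
  · exact Real.rpow_le_one_of_one_le_of_nonpos (by exact_mod_cast hn)
      (neg_nonpos.2 (abs_nonneg δ))

lemma tendsto_smoothWeight {K : Set ℕ} (hK : 0 ∉ K) (n : ℕ) :
    Tendsto (fun δ => smoothWeight K δ n) (𝓝[>] 0) (𝓝 (setWeight K n)) := by
  rcases Nat.eq_zero_or_pos n with rfl | hn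
  · simp [smoothWeight, setWeight, Set.indicator_of_notMem hK]
  · have hn' : (n : ℝ) ≠ 0 := Nat.cast_ne_zero.2 hn.ne'
    have h1 : Continuous fun δ : ℝ => setWeight K n * (n : ℝ) ^ (-|δ|) :=
      continuous_const.mul (Continuous.rpow continuous_const (by fun_prop) fun _ => Or.inl hn')
    have h2 := (h1.tendsto 0).mono_left (nhdsWithin_le_nhds (s := Set.Ioi 0))
    simpa [smoothWeight] using h2

/-- The coefficients `1_K(n) n^{-1-δ}`. -/
def smoothCoeff (K : Set ℕ) (δ : ℝ) (n : ℕ) : ℝ := smoothWeight K δ n * (n : ℝ)⁻¹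

lemma smoothCoeff_nonneg (K : Set ℕ) (δ : ℝ) (n : ℕ) : 0 ≤ smoothCoeff K δ n :=
  mul_nonneg (smoothWeight_nonneg K δ n) (by positivity)

lemma summable_smoothCoeff (K : Set ℕ) {δ : ℝ} (hδ : 0 < δ) : Summable (smoothCoeff K δ) := by
  refine Summable.of_nonneg_of_le (smoothCoeff_nonneg K δ) (fun n => ?_)
    (Real.summable_one_div_nat_rpow.2 (by linarith : 1 < 1 + δ))
  have h := smoothWeight_le_rpow K δ n
  calc smoothCoeff K δ n ≤ (n : ℝ) ^ (-|δ|) * (n : ℝ)⁻¹ := by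
        unfold smoothCoeff
        gcongr
    _ = 1 / (n : ℝ) ^ (1 + δ) := by
        rcases Nat.eq_zero_or_pos n with rfl | hn
        · rw [Nat.cast_zero, inv_zero, mul_zero, Real.zero_rpow (by positivity), div_zero]
        · have hn' : (0 : ℝ) < n := Nat.cast_pos.2 hn
          rw [abs_of_pos hδ, Real.rpow_add hn', Real.rpow_one, Real.rpow_neg hn'.le, one_div, mul_inv,
            mul_comm]

lemma hasSum_re_zetaK {K : Set ℕ} (hK : 0 ∉ K) {δ : ℝ} (hδ : 0 < δ) (u : ℝ) :
    HasSum (fun n : ℕ => smoothCoeff K δ n * Real.cos (Real.log n * u))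
      (zetaK K (1 + (δ : ℂ) + Complex.I * (u : ℂ))).re := by
  have h1 : ∀ n : K, 1 / ((n : ℕ) : ℂ) ^ (1 + (δ : ℂ) + Complex.I * (u : ℂ)) =
      (smoothCoeff K δ n : ℂ) * Complex.exp (((-(Real.log n * u) : ℝ) : ℂ) * Complex.I) := by
    intro n
    have hn0 : (n : ℕ) ≠ 0 := fun h => hK (h ▸ n.2)
    have hn : (0 : ℝ) < ((n : ℕ) : ℝ) := Nat.cast_pos.2 (Nat.pos_of_ne_zero hn0)
    have h2 : smoothCoeff K δ n = Real.exp (-(Real.log n * (1 + δ))) := by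
      rw [smoothCoeff, smoothWeight, setWeight, Set.indicator_of_mem n.2, Pi.one_apply, one_mul,
        abs_of_pos hδ, ← Real.rpow_neg_one, ← Real.rpow_add hn, Real.rpow_def_of_pos hn]
      congr 1
      ring
    rw [h2, Complex.cpow_def_of_ne_zero (Nat.cast_ne_zero.2 hn0), ← Complex.natCast_log, one_div,
      ← Complex.exp_neg, Complex.ofReal_exp, ← Complex.exp_add]
    congr 1
    push_cast
    ring
  have hs : Summable fun n : K => 1 / ((n : ℕ) : ℂ) ^ (1 + (δ : ℂ) + Complex.I * (u : ℂ)) := by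
    refine Summable.of_norm_bounded ((summable_smoothCoeff K hδ).subtype K) fun n => ?_
    rw [h1, norm_mul, Complex.norm_exp_ofReal_mul_I, mul_one, Complex.norm_real,
      Real.norm_of_nonneg (smoothCoeff_nonneg K δ n)]
    rfl
  have h3 := Complex.hasSum_re hs.hasSum
  have h4 : (fun n : K => (1 / ((n : ℕ) : ℂ) ^ (1 + (δ : ℂ) + Complex.I * (u : ℂ))).re) =
      (fun n : ℕ => smoothCoeff K δ n * Real.cos (Real.log n * u)) ∘ (Subtype.val : K → ℕ) := by
    ext n
    rw [h1, Complex.re_ofReal_mul, Complex.exp_ofReal_mul_I_re, Real.cos_neg]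
    rfl
  rw [h4] at h3
  refine (hasSum_subtype_iff_of_support_subset fun n hn => ?_).1 h3
  by_contra hnK
  refine hn ?_
  simp [smoothCoeff, smoothWeight, setWeight, Set.indicator_of_notMem hnK]

/-- The pointwise representative of the smoothed one-sided operator. -/
def smoothSum (T σ : ℝ) (K : Set ℕ) (δ : ℝ) (g : L2Interval T) : BoundedContinuousFunction ℝ ℂ :=
  ∑' n : ℕ, ((smoothCoeff K δ n : ℂ) * inner ℂ (expL2 T (σ * Real.log n)) g) •
    expBCF (σ * Real.log n)

lemma hasSum_smoothSum (T σ : ℝ) (K : Set ℕ) {δ : ℝ} (hδ : 0 < δ) (g : L2Interval T) :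
    HasSum (fun n : ℕ => ((smoothCoeff K δ n : ℂ) * inner ℂ (expL2 T (σ * Real.log n)) g) •
      expBCF (σ * Real.log n)) (smoothSum T σ K δ g) := by
  refine Summable.hasSum (Summable.of_norm_bounded
    ((summable_smoothCoeff K hδ).mul_right (expConst T * ‖g‖)) fun n => ?_)
  rw [norm_smul, norm_mul, Complex.norm_real, Real.norm_of_nonneg (smoothCoeff_nonneg K δ n)]
  have h0 := smoothCoeff_nonneg K δ n
  have h1 := norm_expBCF_le (σ * Real.log n)
  have h2 := norm_inner_le_norm (𝕜 := ℂ) (expL2 T (σ * Real.log n)) g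
  have h3 := norm_expL2_le T (σ * Real.log n)
  have h4 := expConst_nonneg T
  calc _ ≤ smoothCoeff K δ n * (expConst T * ‖g‖) * 1 := by
        gcongr
        exact h2.trans (by gcongr)
    _ = _ := mul_one _

/-- For `δ > 0` the series converges uniformly, which links pointwise values of the convolution with
the `L²` operator. -/
lemma toLp_smoothSum (T : ℝ) {σ : ℝ} (hσ : |σ| = 1) (K : Set ℕ) {δ : ℝ} (hδ : 0 < δ)
    (g : L2Interval T) :
    BoundedContinuousFunction.toLp 2 (volume.restrict (Set.Ioo (-T) T)) ℂ (smoothSum T σ K δ g) =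
      logFrameOp T hσ (smoothWeight K δ) (abs_smoothWeight_le K δ) g := by
  have h1 := (hasSum_smoothSum T σ K hδ g).mapL
    (BoundedContinuousFunction.toLp 2 (volume.restrict (Set.Ioo (-T) T)) ℂ)
  refine h1.unique ?_
  rw [logFrameOp]
  convert (isBessel_logVec T 0 hσ).hasSum_frameOp _ (abs_smoothWeight_le K δ) g using 2 with n
  rw [mul_smul (smoothWeight K δ n : ℂ), inner_logVec_smul, map_smul, add_zero, expOp_apply,
    RCLike.real_smul_eq_coe_smul (K := ℂ), smul_smul, smul_smul, smoothCoeff, Complex.ofReal_mul]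
  rfl

/-- Absolute convergence for `δ > 0` allows termwise integration, and the cosine splits into two
exponentials; its `1/2` turns `1/π` into `1/(2π)`. -/
lemma zetaConvolution_eq {K : Set ℕ} (hK : 0 ∉ K) (T : ℝ) {δ : ℝ} (hδ : 0 < δ) (g : L2Interval T)
    (t : ℝ) :
    zetaConvolution K T δ g t =
      ((2 * Real.pi : ℝ) : ℂ)⁻¹ * (smoothSum T 1 K δ g t + smoothSum T (-1) K δ g t) := by
  set μ := volume.restrict (Set.Ioo (-T) T) with hμ
  have hg := integrableOn_coe g
  set F : ℕ → ℝ → ℂ := fun n τ =>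
    g τ * ((smoothCoeff K δ n * Real.cos (Real.log n * (t - τ)) : ℝ) : ℂ) with hF
  have hmeas : ∀ n, AEStronglyMeasurable (F n) μ := fun n =>
    hg.aestronglyMeasurable.mul (by fun_prop : Continuous fun τ : ℝ =>
      ((smoothCoeff K δ n * Real.cos (Real.log n * (t - τ)) : ℝ) : ℂ)).aestronglyMeasurable
  have hnorm : ∀ n τ, ‖F n τ‖ ≤ smoothCoeff K δ n * ‖g τ‖ := by
    intro n τ
    rw [hF, norm_mul, Complex.norm_real, norm_mul, Real.norm_of_nonneg (smoothCoeff_nonneg K δ n),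
      mul_comm, Real.norm_eq_abs]
    have h0 := smoothCoeff_nonneg K δ n
    have := Real.abs_cos_le_one (Real.log n * (t - τ))
    gcongr
    exact mul_le_of_le_one_right h0 this
  have hint : ∀ n, Integrable (F n) μ := fun n =>
    (hg.norm.const_mul (smoothCoeff K δ n)).mono' (hmeas n) (Eventually.of_forall (hnorm n))
  have hsum : Summable fun n => ∫ τ, ‖F n τ‖ ∂μ := by
    refine Summable.of_nonneg_of_le (fun n => integral_nonneg fun _ => norm_nonneg _) (fun n => ?_)
      ((summable_smoothCoeff K hδ).mul_right (∫ τ, ‖g τ‖ ∂μ))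
    rw [← integral_const_mul]
    exact integral_mono (hint n).norm (hg.norm.const_mul _) (hnorm n)
  have h1 := hasSum_integral_of_summable_integral_norm hint hsum
  have h2 : ∀ τ, ∑' n, F n τ =
      g τ * (((zetaK K (1 + (δ : ℂ) + Complex.I * ((t : ℂ) - (τ : ℂ)))).re : ℝ) : ℂ) := by
    intro τ
    have := (Complex.hasSum_ofReal.2 (hasSum_re_zetaK hK hδ (t - τ))).mul_left (g τ)
    rw [Complex.ofReal_sub] at this
    exact this.tsum_eq
  simp only [h2] at h1
  have hexp : ∀ x : ℝ, Integrable (fun τ : ℝ => Complex.exp (-((x * τ : ℝ) * Complex.I)) * g τ) μ := by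
    intro x
    refine hg.norm.mono' ((by fun_prop : Continuous fun τ : ℝ =>
      Complex.exp (-((x * τ : ℝ) * Complex.I))).aestronglyMeasurable.mul hg.aestronglyMeasurable)
      (Eventually.of_forall fun τ => ?_)
    rw [norm_mul, ← neg_mul, ← Complex.ofReal_neg, Complex.norm_exp_ofReal_mul_I, one_mul]
  have h3 : ∀ n : ℕ, ∫ τ, F n τ ∂μ = (2 : ℂ)⁻¹ *
      (((smoothCoeff K δ n : ℂ) * inner ℂ (expL2 T (1 * Real.log n)) g) * expBCF (1 * Real.log n) t +
      ((smoothCoeff K δ n : ℂ) * inner ℂ (expL2 T (-1 * Real.log n)) g) *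
        expBCF (-1 * Real.log n) t) := by
    intro n
    have h4 : ∀ τ, F n τ =
        ((2 : ℂ)⁻¹ * (smoothCoeff K δ n : ℂ) * expBCF (1 * Real.log n) t) *
          (Complex.exp (-((1 * Real.log n * τ : ℝ) * Complex.I)) * g τ) +
        ((2 : ℂ)⁻¹ * (smoothCoeff K δ n : ℂ) * expBCF (-1 * Real.log n) t) *
          (Complex.exp (-((-1 * Real.log n * τ : ℝ) * Complex.I)) * g τ) := by
      intro τ
      have h5 : ((Real.cos (Real.log n * (t - τ)) : ℝ) : ℂ) = (2 : ℂ)⁻¹ *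
          (expBCF (1 * Real.log n) t * Complex.exp (-((1 * Real.log n * τ : ℝ) * Complex.I)) +
          expBCF (-1 * Real.log n) t * Complex.exp (-((-1 * Real.log n * τ : ℝ) * Complex.I))) := by
        rw [expBCF_apply, expBCF_apply, ← Complex.exp_add, ← Complex.exp_add, Complex.ofReal_cos,
          Complex.cos, div_eq_inv_mul]
        congr 3
        · push_cast
          ring
        · push_cast
          ring
      simp only [hF]
      rw [Complex.ofReal_mul, h5]
      ring
    simp only [h4]
    rw [integral_add ((hexp _).const_mul _) ((hexp _).const_mul _), integral_const_mul,
      integral_const_mul, ← inner_expL2, ← inner_expL2]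
    ring
  simp only [h3] at h1
  have hev : ∀ σ : ℝ, HasSum (fun n : ℕ =>
      ((smoothCoeff K δ n : ℂ) * inner ℂ (expL2 T (σ * Real.log n)) g) * expBCF (σ * Real.log n) t)
      (smoothSum T σ K δ g t) := fun σ =>
    (hasSum_smoothSum T σ K hδ g).mapL (BoundedContinuousFunction.evalCLM ℂ t)
  have h6 := h1.unique (((hev 1).add (hev (-1))).mul_left (2 : ℂ)⁻¹)
  rw [zetaConvolution, h6, Complex.ofReal_mul, mul_inv, Complex.ofReal_ofNat]
  ring

/-- The operator `𝓩_{K,I}`. -/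
def zetaOp (T : ℝ) (K : Set ℕ) : L2Interval T →L[ℂ] L2Interval T :=
  ((2 * Real.pi : ℝ) : ℂ)⁻¹ • (halfZetaOp T (σ := 1) (by simp) K + halfZetaOp T (σ := -1) (by simp) K)

lemma isZetaOperator_zetaOp {K : Set ℕ} (hK : 0 ∉ K) (T : ℝ) : IsZetaOperator K T (zetaOp T K) := by
  intro g
  have h1 : |(1 : ℝ)| = 1 := by simp
  have h2 : |(-1 : ℝ)| = 1 := by simp
  set Zδ : ℝ → L2Interval T := fun δ => ((2 * Real.pi : ℝ) : ℂ)⁻¹ •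
    (logFrameOp T h1 (smoothWeight K δ) (abs_smoothWeight_le K δ) g +
      logFrameOp T h2 (smoothWeight K δ) (abs_smoothWeight_le K δ) g) with hZδ
  have hlim : Tendsto Zδ (𝓝[>] 0) (𝓝 (zetaOp T K g)) := by
    refine Tendsto.const_smul (Tendsto.add ?_ ?_) _
    · exact (isBessel_logVec T 0 h1).tendsto_frameOp (abs_smoothWeight_le K) (abs_setWeight_le K)
        (tendsto_smoothWeight hK) g
    · exact (isBessel_logVec T 0 h2).tendsto_frameOp (abs_smoothWeight_le K) (abs_setWeight_le K)
        (tendsto_smoothWeight hK) g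
  have hlim' : Tendsto (fun δ => ENNReal.ofReal ‖Zδ δ - zetaOp T K g‖) (𝓝[>] 0) (𝓝 0) := by
    have := ENNReal.tendsto_ofReal (tendsto_iff_norm_sub_tendsto_zero.1 hlim)
    rwa [ENNReal.ofReal_zero] at this
  refine hlim'.congr' ?_
  filter_upwards [self_mem_nhdsWithin] with δ hδ
  rw [ofReal_norm, Lp.enorm_def]
  refine eLpNorm_congr_ae ?_
  have h3 : Zδ δ = BoundedContinuousFunction.toLp 2 (volume.restrict (Set.Ioo (-T) T)) ℂ
      (((2 * Real.pi : ℝ) : ℂ)⁻¹ • (smoothSum T 1 K δ g + smoothSum T (-1) K δ g)) := by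
    rw [map_smul, map_add, toLp_smoothSum T h1 K hδ, toLp_smoothSum T h2 K hδ]
  rw [h3]
  filter_upwards [Lp.coeFn_sub (BoundedContinuousFunction.toLp 2 (volume.restrict (Set.Ioo (-T) T)) ℂ
      (((2 * Real.pi : ℝ) : ℂ)⁻¹ • (smoothSum T 1 K δ g + smoothSum T (-1) K δ g))) (zetaOp T K g),
    BoundedContinuousFunction.coeFn_toLp 2 (volume.restrict (Set.Ioo (-T) T)) ℂ
      (((2 * Real.pi : ℝ) : ℂ)⁻¹ • (smoothSum T 1 K δ g + smoothSum T (-1) K δ g))] with t ht1 ht2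
  rw [ht1, Pi.sub_apply, ht2, zetaConvolution_eq hK T hδ]
  rfl

/-! ### Scalar plus compact, and the lower bound. -/

lemma isCompactOperator_halfZetaOp_sub_limitDensity (T : ℝ) {σ : ℝ} (hσ : |σ| = 1) (Q : Set ℕ) :
    IsCompactOperator (halfZetaOp T hσ (generatedIntegers Q) -
      limitDensity Q • logFrameOp T hσ 1 (by simp) : L2Interval T →L[ℂ] L2Interval T) := by
  by_cases hs : Summable (fun p : complementaryPrimes Q => 1 / ((p : ℕ) : ℝ))
  · exact isCompactOperator_halfZetaOp_sub T hσ fun ε hε => exists_sieve_approx hs hε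
  · have h0 : limitDensity Q = 0 := by
      have h := mt (summable_complementaryPrimes_iff Q).2 hs
      exact le_antisymm (not_lt.1 h) (limitDensity_nonneg Q)
    rw [h0, zero_smul, sub_zero]
    exact isCompactOperator_halfZetaOp T hσ fun ε hε => exists_sieveDensity_le_of_not_summable hs hε

lemma isCompactOperator_zetaOp_sub (T : ℝ) (Q : Set ℕ) :
    IsCompactOperator (zetaOp T (generatedIntegers Q) -
      ((limitDensity Q : ℝ) : ℂ) • ContinuousLinearMap.id ℂ (L2Interval T) :
      L2Interval T →L[ℂ] L2Interval T) := by
  have h1 : |(1 : ℝ)| = 1 := by simp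
  have h2 : |(-1 : ℝ)| = 1 := by simp
  obtain ⟨R, hR, hL⟩ := logFrameOp_one_add_eq T
  set A := halfZetaOp T h1 (generatedIntegers Q)
  set B := halfZetaOp T h2 (generatedIntegers Q)
  set L₁ := logFrameOp T h1 1 (by simp)
  set L₂ := logFrameOp T h2 1 (by simp)
  have hA : IsCompactOperator (A - limitDensity Q • L₁) :=
    isCompactOperator_halfZetaOp_sub_limitDensity T h1 Q
  have hB : IsCompactOperator (B - limitDensity Q • L₂) :=
    isCompactOperator_halfZetaOp_sub_limitDensity T h2 Q
  have hpi : ((2 * Real.pi : ℝ) : ℂ) ≠ 0 := by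
    exact_mod_cast (by positivity : (2 * Real.pi) ≠ 0)
  have hmem : ((2 * Real.pi : ℝ) : ℂ)⁻¹ • ((A - limitDensity Q • L₁) + (B - limitDensity Q • L₂) +
      ((limitDensity Q : ℝ) : ℂ) • R) ∈
      compactOperator (RingHom.id ℂ) (L2Interval T) (L2Interval T) :=
    Submodule.smul_mem _ _ (Submodule.add_mem _ (Submodule.add_mem _ hA hB)
      (Submodule.smul_mem _ _ hR))
  have heq : zetaOp T (generatedIntegers Q) -
      ((limitDensity Q : ℝ) : ℂ) • ContinuousLinearMap.id ℂ (L2Interval T) =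
      ((2 * Real.pi : ℝ) : ℂ)⁻¹ • ((A - limitDensity Q • L₁) + (B - limitDensity Q • L₂) +
      ((limitDensity Q : ℝ) : ℂ) • R) := by
    have hR' : R = L₁ + L₂ - ((2 * Real.pi : ℝ) : ℂ) • ContinuousLinearMap.id ℂ (L2Interval T) := by
      rw [hL]
      abel
    have hr : ∀ S : L2Interval T →L[ℂ] L2Interval T,
        limitDensity Q • S = ((limitDensity Q : ℝ) : ℂ) • S := fun S =>
      RCLike.real_smul_eq_coe_smul (K := ℂ) _ S
    rw [hR', hr, hr, zetaOp]
    match_scalars <;> field_simp <;> ring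
  rw [heq]
  exact hmem

/-- With a finite orthonormal basis, `∑ᵢ |⟨e^{ixt}, bᵢ⟩|² = ‖e^{ixt}‖² = 2T` would be constant in
`x`, yet integrable over `ℝ` by Plancherel. -/
lemma not_finiteDimensional_L2Interval {T : ℝ} (hT : 0 < T) :
    ¬ FiniteDimensional ℂ (L2Interval T) := by
  intro hfin
  let b := stdOrthonormalBasis ℂ (L2Interval T)
  have h1 : Integrable (fun x => ∑ i, ‖inner ℂ (expL2 T x) (b i)‖ ^ 2) volume :=
    integrable_finsetSum _ fun i _ => (plancherel_expL2 (b i)).1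
  have h2 : ∀ x, ∑ i, ‖inner ℂ (expL2 T x) (b i)‖ ^ 2 = 2 * T := by
    intro x
    rw [b.sum_sq_norm_inner_left, ← integral_norm_sq_coeFn]
    have h3 : ∫ t in Set.Ioo (-T) T, ‖expL2 T x t‖ ^ 2 = ∫ t in Set.Ioo (-T) T, (1 : ℝ) := by
      refine integral_congr_ae ?_
      filter_upwards [coeFn_expL2 T x] with t ht
      rw [ht, Complex.norm_exp_ofReal_mul_I, one_pow]
    rw [h3, setIntegral_const, smul_eq_mul, mul_one, Real.volume_real_Ioo_of_le (by linarith)]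
    ring
  simp only [h2] at h1
  rw [integrable_const_iff] at h1
  rcases h1 with h1 | h1
  · linarith
  · exact absurd h1.measure_univ_lt_top (by simp)

/-- A bounded below operator is a closed embedding, so pulling back a compact set gives a compact
neighbourhood of `0`. -/
lemma finiteDimensional_of_isCompactOperator_of_isBoundedBelow {H : Type*} [NormedAddCommGroup H]
    [NormedSpace ℂ H] [CompleteSpace H] {Z : H →L[ℂ] H} (hZ : IsCompactOperator Z) {c : ℝ}
    (hc : 0 < c) (hb : ∀ g, c * ‖g‖ ≤ ‖Z g‖) : FiniteDimensional ℂ H := by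
  obtain ⟨S, hS, hS0⟩ := hZ
  obtain ⟨K, hK⟩ := (antilipschitzWith_iff_exists_mul_le_norm (f := Z)).2 ⟨c, hc, hb⟩
  have hemb := hK.isClosedEmbedding Z.uniformContinuous
  exact FiniteDimensional.of_isCompactOperator_id (𝕜 := ℂ) ⟨Z ⁻¹' S, hemb.isCompact_preimage hS, hS0⟩

/-- `⟨g, 𝓩 g⟩` is a sum of nonnegative terms, so all vanish; the terms with `σ = 1` already suffice.
-/
lemma eq_zero_of_zetaOp_eq_zero {T : ℝ} (hT : 0 < T) {Q : Set ℕ} (hQ : ∀ p ∈ Q, p.Prime)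
    (hs : Summable (fun p : complementaryPrimes Q => 1 / ((p : ℕ) : ℝ))) (g : L2Interval T)
    (hg : zetaOp T (generatedIntegers Q) g = 0) : g = 0 := by
  have h1 : |(1 : ℝ)| = 1 := by simp
  have h2 : |(-1 : ℝ)| = 1 := by simp
  have hpi : ((2 * Real.pi : ℝ) : ℂ)⁻¹ ≠ 0 := by
    exact inv_ne_zero (by exact_mod_cast (by positivity : (2 * Real.pi) ≠ 0))
  rw [zetaOp, smul_apply, smul_eq_zero_iff_right hpi, add_apply] at hg
  have h3 := congrArg (fun u => (inner ℂ g u).re) hg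
  simp only [inner_add_right, Complex.add_re, re_inner_halfZetaOp, inner_zero_right,
    Complex.zero_re] at h3
  have hnn : ∀ (σ : ℝ) n, 0 ≤ setWeight (generatedIntegers Q) n * ‖inner ℂ (logVec T σ 0 n) g‖ ^ 2 :=
    fun σ n => mul_nonneg (setWeight_nonneg _ n) (by positivity)
  have h4 : ∑' n, setWeight (generatedIntegers Q) n * ‖inner ℂ (logVec T 1 0 n) g‖ ^ 2 = 0 :=
    ((add_eq_zero_iff_of_nonneg (tsum_nonneg (hnn 1)) (tsum_nonneg (hnn (-1)))).1 h3).1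
  have hsum := (isBessel_logVec T 0 h1).summable_weight_mul_sq
    (abs_setWeight_le (generatedIntegers Q)) g
  refine eq_zero_of_inner_expL2_log_eq_zero hT hQ hs g fun n hn => ?_
  have h5 := congrFun ((hasSum_zero_iff_of_nonneg (hnn 1)).1 (h4 ▸ hsum.hasSum)) n
  simp only [Pi.zero_apply] at h5
  rw [setWeight, Set.indicator_of_mem hn, Pi.one_apply, one_mul, norm_inner_logVec_sq, one_mul,
    add_zero] at h5
  have hn0 : ((n : ℝ))⁻¹ ≠ 0 := inv_ne_zero (Nat.cast_ne_zero.2 hn.1.ne')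
  simpa [hn0, hn.1.ne'] using h5

lemma isBoundedBelow_zetaOp_iff {T : ℝ} (hT : 0 < T) {Q : Set ℕ} (hQ : ∀ p ∈ Q, p.Prime) :
    IsBoundedBelow (zetaOp T (generatedIntegers Q)) ↔
      Summable (fun p : complementaryPrimes Q => 1 / ((p : ℕ) : ℝ)) := by
  have hcomp := isCompactOperator_zetaOp_sub T Q
  constructor
  · rintro ⟨c, hc, hb⟩
    rw [summable_complementaryPrimes_iff]
    refine lt_of_le_of_ne (limitDensity_nonneg Q) fun h0 => ?_
    rw [← h0, Complex.ofReal_zero, zero_smul, sub_zero] at hcomp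
    exact not_finiteDimensional_L2Interval hT
      (finiteDimensional_of_isCompactOperator_of_isBoundedBelow hcomp hc hb)
  · intro hs
    have hd := (summable_complementaryPrimes_iff Q).1 hs
    have hd' : -((limitDensity Q : ℝ) : ℂ) ≠ 0 := neg_ne_zero.2 (by exact_mod_cast hd.ne')
    set Z := zetaOp T (generatedIntegers Q) with hZ
    -- With `d` the limiting density, `Z = Ψ - (-d)·1`, so the kernel of `Z` is the eigenspace of
    -- the compact `Ψ` at `-d ≠ 0`.
    have heq : Z - ((limitDensity Q : ℝ) : ℂ) • ContinuousLinearMap.id ℂ (L2Interval T) -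
        (-((limitDensity Q : ℝ) : ℂ)) • (1 : L2Interval T →L[ℂ] L2Interval T) = Z := by
      rw [neg_smul, sub_neg_eq_add]
      exact sub_add_cancel _ _
    have h1 := hcomp.antilipschitz_of_not_hasEigenvalue hd' (fun hev => by
      obtain ⟨g, hg⟩ := hev.exists_hasEigenvector
      refine hg.2 (eq_zero_of_zetaOp_eq_zero hT hQ hs g ?_)
      have h2 := hg.apply_eq_smul
      rw [← hZ, ← heq, sub_apply, sub_eq_zero]
      exact h2)
    rw [heq, antilipschitzWith_iff_exists_mul_le_norm] at h1
    exact h1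

end

theorem theorem4 (T : ℝ) (hT : 0 < T) (Q : Set ℕ) (hQ : ∀ p ∈ Q, p.Prime) :
    ∃ Z : L2Interval T →L[ℂ] L2Interval T,
      IsZetaOperator (generatedIntegers Q) T Z ∧
      (∃ Ψ : L2Interval T →L[ℂ] L2Interval T,
        IsCompactOperator Ψ ∧
        Z = (((zetaKAtOne (generatedIntegers (complementaryPrimes Q)))⁻¹.toReal : ℝ) : ℂ) •
              ContinuousLinearMap.id ℂ (L2Interval T) + Ψ) ∧
      (IsBoundedBelow Z ↔
        Summable (fun p : complementaryPrimes Q => 1 / ((p : ℕ) : ℝ))) :=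
  ⟨zetaOp T (generatedIntegers Q), isZetaOperator_zetaOp (fun h => lt_irrefl 0 h.1) T,
    ⟨_, isCompactOperator_zetaOp_sub T Q, (add_sub_cancel _ _).symm⟩,
    isBoundedBelow_zetaOp_iff hT hQ⟩
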